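/- **Theorem (Normal forms with respect to contact equivalence).** Let $K$ be an algebraically closed field of arbitrary characteristic, $n\ge 1$, $K[[x]]=K[[x_1,\dots,x_n]]$, $\mathfrak m=\langle x_1,\dots,x_n\rangle$, and let $\operatorname{ord}$ be the order of a power series. For $f\in K[[x]]$ let $j(f)=\langle f_{x_1},\dots,f_{x_n}\rangle$ be its Jacobian ideal. Two power series $f,g$ are contact equivalent, $f\sim_c g$, if $f=u\cdot\varphi(g)$ for a unit $u$ and a $K$-algebra automorphism $\varphi$ of $K[[x]]$. A $C$-polytope $P$ is given by a finite non-empty set of weight vectors $w_1,\dots,w_s\in\mathbb Q_{>0}^n$ which is irredundant, i.e. none of the linear functions $r\mapsto w_i\cdot r$ can be omitted from the minimum $\lambda_P(r)=\min_i w_i\cdot r$, $r\in\mathbb R^n$. (As a set, $P=\{r\in\mathbb R_{\ge0}^n : \lambda_P(r)=1\}$.) Let $N_P$ be the least common multiple of the denominators of all entries of the $w_i$. For $f=\sum_\alpha a_\alpha x^\alpha\in K[[x]]$ and $\xi=\sum_{i,\alpha}a_{i,\alpha}x^\alpha\partial_{x_i}\in \operatorname{Der}_K(K[[x]])$ put $$v_P(f)=\min\{N_P\lambda_P(\alpha)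 : a_\alpha\ne0\},\qquad v_P(\xi)=\min\{N_P\lambda_P(\alpha-e_i) : a_{i,\alpha}\ne 0\},$$ with value $\infty$ for $f=0$ and $\xi=0$, where $e_i$ is the $i$-th standard basis vector. Let $\operatorname{In}_P(f)$ be the sum of the terms $a_\alpha x^\alpha$, $a_\alpha\neq 0$, with $\lambda_P(\alpha)$ minimal, and for $d\in\mathbb N$ let $$F_d=\{h\in K[[x]] : v_P(h)\ge d\},\qquad tj_P^{AC}(f)_d=\{gf+\xi f : g\in K[[x]],\ \xi\in\operatorname{Der}_K(K[[x]]),\ \min\{v_P(g)+v_P(f),\,v_P(\xi)+v_P(f)\}\ge d\},$$ $$gr_P^{AC}(T_f)=\bigoplus_{d\ge0}F_d/\big(tj_P^{AC}(f)_d+F_{d+1}\big).$$ A set of monomials $\{x^\alpha : \alpha\in\Lambda\}$, $\Lambda\subseteq\mathbb N^n$, is a regular basis for $T_f$ if the classes of the $x^\alpha$, $\alpha\in\Lambda$ (the class of $x^\alpha$ being taken in degree $v_P(x^\alpha)$), form a $K$-basis of $gr_P^{AC}(T_f)$. Let $f\in\mathfrak m$, let $P$ be a $C$-polytope, let $\{x^\alpha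 : \alpha\in\Lambda\}$ be a regular basis for $T_{\operatorname{In}_P(f)}$, and let $k\in\mathbb N$ be such that $$\mathfrak m^{k+2}\subseteq \mathfrak m\cdot\langle f\rangle+\mathfrak m^2\cdot j(f).$$ Then the set $$\Lambda_f=\{\alpha\in\Lambda : \deg(x^\alpha)\le 2k-\operatorname{ord}(f)+2,\ v_P(x^\alpha)\ge v_P(f-\operatorname{In}_P(f))\}$$ is finite, and there are $c_\alpha\in K$ such that $$f\ \sim_c\ \operatorname{In}_P(f)+\sum_{\alpha\in\Lambda_f}c_\alpha x^\alpha .$$ -/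

import Mathlib

noncomputable section

namespace SingNF

/-- A `C`-polytope in `ℝⁿ`, given by the finite irredundant set of its weight vectors
(the suitably scaled inner normals of its facets). A weight `w` is superfluous when the minimum
`λ` of the linear functions of all weights does not change after `w` is left out. -/
structure CPolytope (n : ℕ) where
  weights : Finset (Fin n → ℚ)
  weights_nonempty : weights.Nonempty
  weights_pos : ∀ w ∈ weights, ∀ j, 0 < w j
  irredundant : ∀ w ∈ weights, ∃ r : Fin n → ℝ, ∀ w' ∈ weights, w' ≠ w →
    ∑ j, (w j : ℝ) * r j < ∑ j, (w' j : ℝ) * r j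

namespace CPolytope

variable {n : ℕ} (P : CPolytope n)

/-- The piecewise linear function `λ_P`, the minimum of the linear functions of the weights. -/
def lam (r : Fin n → ℝ) : ℝ :=
  P.weights.inf' P.weights_nonempty fun w => ∑ j, (w j : ℝ) * r j

/-- `N_P`: the least common multiple of the denominators of all entries of the weights. -/
def N : ℕ := P.weights.lcm fun w => Finset.univ.lcm fun j => (w j).den

/-- `N_P * λ_P (a)` for an integer vector `a` (entries may be negative). -/
def deg (a : Fin n → ℤ) : ℝ := (P.N : ℝ) * P.lam fun j => (a j : ℝ)

/-- `N_P * λ_P (α)` for an exponent vector `α`. -/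
def expDeg (α : Fin n →₀ ℕ) : ℝ := P.deg fun j => (α j : ℤ)

theorem lam_le_lam {r s : Fin n → ℝ} (h : ∀ j, r j ≤ s j) : P.lam r ≤ P.lam s := by
  refine Finset.le_inf' _ _ fun w hw => (Finset.inf'_le _ hw).trans ?_
  refine Finset.sum_le_sum fun j _ => mul_le_mul_of_nonneg_left (h j) ?_
  exact_mod_cast (P.weights_pos w hw j).le

theorem lam_nonneg {r : Fin n → ℝ} (h : ∀ j, 0 ≤ r j) : 0 ≤ P.lam r := by
  refine Finset.le_inf' _ _ fun w hw => Finset.sum_nonneg fun j _ => mul_nonneg ?_ (h j)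
  exact_mod_cast (P.weights_pos w hw j).le

theorem deg_le_deg {a b : Fin n → ℤ} (h : ∀ j, a j ≤ b j) : P.deg a ≤ P.deg b :=
  mul_le_mul_of_nonneg_left (P.lam_le_lam fun j => by exact_mod_cast h j) (Nat.cast_nonneg _)

theorem expDeg_nonneg (α : Fin n →₀ ℕ) : 0 ≤ P.expDeg α :=
  mul_nonneg (Nat.cast_nonneg _) (P.lam_nonneg fun j => by simp)

theorem exists_int_deg (a : Fin n → ℤ) : ∃ z : ℤ, P.deg a = z := by
  obtain ⟨w, hw, h⟩ := Finset.exists_mem_eq_inf' P.weights_nonempty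
    fun w : Fin n → ℚ => ∑ j, (w j : ℝ) * (a j : ℝ)
  have key : ∀ j, ∃ z : ℤ, (P.N : ℝ) * (w j : ℝ) = z := by
    intro j
    have h1 : (w j).den ∣ P.N :=
      (Finset.dvd_lcm (f := fun j => (w j).den) (Finset.mem_univ j)).trans
        (Finset.dvd_lcm (f := fun w : Fin n → ℚ => Finset.univ.lcm fun j => (w j).den) hw)
    obtain ⟨c, hc⟩ := h1
    refine ⟨c * (w j).num, ?_⟩
    have h2 : ((w j).den : ℚ) * w j = (w j).num := Rat.den_mul_eq_num (w j)
    have h3 : (P.N : ℚ) * w j = c * (w j).num := by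
      rw [hc, ← h2]; push_cast; ring
    exact_mod_cast h3
  choose z hz using key
  refine ⟨∑ j, z j * a j, ?_⟩
  unfold deg lam
  rw [h, Finset.mul_sum]
  push_cast
  exact Finset.sum_congr rfl fun j _ => by rw [← hz j]; ring

/-- The piecewise degree `v_P(x^α)` as a natural number (the floor is exact). -/
def monDeg (α : Fin n →₀ ℕ) : ℕ := ⌊P.expDeg α⌋₊

theorem cast_monDeg (α : Fin n →₀ ℕ) : (P.monDeg α : ℝ) = P.expDeg α := by
  obtain ⟨z, hz⟩ := P.exists_int_deg fun j => (α j : ℤ)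
  have h0 : P.expDeg α = z := hz
  have h1 : 0 ≤ z := by
    have := P.expDeg_nonneg α
    rw [h0] at this
    exact_mod_cast this
  lift z to ℕ using h1
  unfold monDeg
  rw [h0]
  simp

variable {K : Type*} [Field K]

/-- The piecewise valuation `v_P` of a power series, with `v_P(0) = ∞`. -/
def val (f : MvPowerSeries (Fin n) K) : EReal :=
  ⨅ (α : Fin n →₀ ℕ) (_ : MvPowerSeries.coeff α f ≠ 0), (P.expDeg α : EReal)

/-- The piecewise valuation of a derivation `ξ = ∑ᵢ aᵢ ∂ᵢ`, `aᵢ = ξ xᵢ`: the minimum of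
`N_P * λ_P (α - eᵢ)` over all monomials `x^α` that occur in `aᵢ`. -/
def derVal (ξ : Derivation K (MvPowerSeries (Fin n) K) (MvPowerSeries (Fin n) K)) : EReal :=
  ⨅ (i : Fin n) (α : Fin n →₀ ℕ)
    (_ : MvPowerSeries.coeff α (ξ (MvPowerSeries.X i)) ≠ 0),
    ((P.deg fun j => (α j : ℤ) - (Pi.single i 1 : Fin n → ℤ) j : ℝ) : EReal)

/-- The initial form (principal part) of `f`: the sum of the terms of `f` of minimal
piecewise degree. -/
def initialForm (f : MvPowerSeries (Fin n) K) : MvPowerSeries (Fin n) K := fun α =>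
  open Classical in
  if (P.expDeg α : EReal) = P.val f then MvPowerSeries.coeff α f else 0

theorem le_val_iff {e : EReal} {f : MvPowerSeries (Fin n) K} :
    e ≤ P.val f ↔ ∀ α, MvPowerSeries.coeff α f ≠ 0 → e ≤ (P.expDeg α : EReal) := by
  simp [val, le_iInf_iff]

theorem le_derVal_iff {e : EReal}
    {ξ : Derivation K (MvPowerSeries (Fin n) K) (MvPowerSeries (Fin n) K)} :
    e ≤ P.derVal ξ ↔ ∀ i α, MvPowerSeries.coeff α (ξ (MvPowerSeries.X i)) ≠ 0 →
      e ≤ ((P.deg fun j => (α j : ℤ) - (Pi.single i 1 : Fin n → ℤ) j : ℝ) : EReal) := by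
  simp [derVal, le_iInf_iff]

theorem val_zero : P.val (0 : MvPowerSeries (Fin n) K) = ⊤ := by simp [val]

theorem derVal_zero :
    P.derVal (0 : Derivation K (MvPowerSeries (Fin n) K) (MvPowerSeries (Fin n) K)) = ⊤ := by
  simp [derVal]

theorem min_le_val_add (f g : MvPowerSeries (Fin n) K) :
    min (P.val f) (P.val g) ≤ P.val (f + g) := by
  rw [le_val_iff]
  intro α h
  rw [map_add] at h
  by_cases hf : MvPowerSeries.coeff α f = 0
  · have hg : MvPowerSeries.coeff α g ≠ 0 := by simpa [hf] using h
    exact (min_le_right _ _).trans (P.le_val_iff.1 le_rfl α hg)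
  · exact (min_le_left _ _).trans (P.le_val_iff.1 le_rfl α hf)

theorem min_le_derVal_add
    (ξ η : Derivation K (MvPowerSeries (Fin n) K) (MvPowerSeries (Fin n) K)) :
    min (P.derVal ξ) (P.derVal η) ≤ P.derVal (ξ + η) := by
  rw [le_derVal_iff]
  intro i α h
  rw [Derivation.add_apply, map_add] at h
  by_cases hf : MvPowerSeries.coeff α (ξ (MvPowerSeries.X i)) = 0
  · have hg : MvPowerSeries.coeff α (η (MvPowerSeries.X i)) ≠ 0 := by simpa [hf] using h
    exact (min_le_right _ _).trans (P.le_derVal_iff.1 le_rfl i α hg)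
  · exact (min_le_left _ _).trans (P.le_derVal_iff.1 le_rfl i α hf)

theorem exists_of_coeff_mul_ne_zero {h g : MvPowerSeries (Fin n) K} {α : Fin n →₀ ℕ}
    (H : MvPowerSeries.coeff α (h * g) ≠ 0) :
    ∃ γ, MvPowerSeries.coeff γ g ≠ 0 ∧ ∀ j, γ j ≤ α j := by
  classical
  rw [MvPowerSeries.coeff_mul] at H
  obtain ⟨p, hp, h1⟩ := Finset.exists_ne_zero_of_sum_ne_zero H
  refine ⟨p.2, right_ne_zero_of_mul h1, fun j => ?_⟩
  rw [← Finset.HasAntidiagonal.mem_antidiagonal.1 hp]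
  simp

theorem val_le_val_mul (h g : MvPowerSeries (Fin n) K) : P.val g ≤ P.val (h * g) := by
  rw [le_val_iff]
  intro α H
  obtain ⟨γ, h1, h2⟩ := exists_of_coeff_mul_ne_zero H
  refine (P.le_val_iff.1 le_rfl γ h1).trans (EReal.coe_le_coe_iff.2 ?_)
  exact P.deg_le_deg fun j => by exact_mod_cast h2 j

theorem derVal_le_derVal_smul (h : MvPowerSeries (Fin n) K)
    (ξ : Derivation K (MvPowerSeries (Fin n) K) (MvPowerSeries (Fin n) K)) :
    P.derVal ξ ≤ P.derVal (h • ξ) := by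
  rw [le_derVal_iff]
  intro i α H
  rw [Derivation.smul_apply, smul_eq_mul] at H
  obtain ⟨γ, h1, h2⟩ := exists_of_coeff_mul_ne_zero H
  refine (P.le_derVal_iff.1 le_rfl i γ h1).trans (EReal.coe_le_coe_iff.2 ?_)
  refine P.deg_le_deg fun j => ?_
  have := h2 j
  omega

variable (K) in
/-- The filtration `F_d = {f | v_P(f) ≥ d}` by ideals. -/
def filt (d : ℕ) : Ideal (MvPowerSeries (Fin n) K) where
  carrier := {f | ((d : ℝ) : EReal) ≤ P.val f}
  zero_mem' := by simp [val_zero]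
  add_mem' {f g} hf hg := (le_min hf hg).trans (P.min_le_val_add f g)
  smul_mem' h g hg := le_trans hg (P.val_le_val_mul h g)

theorem monomial_mem_filt (α : Fin n →₀ ℕ) :
    MvPowerSeries.monomial α (1 : K) ∈ P.filt K (P.monDeg α) := by
  classical
  change _ ≤ P.val _
  rw [le_val_iff]
  intro β h
  rw [MvPowerSeries.coeff_monomial] at h
  have hb : β = α := by
    by_contra hne
    simp [hne] at h
  rw [hb, cast_monDeg]

/-- The ideal `tj_P^{AC}(f)_d` of all `g f + ξ f` with
`min (v_P(g) + v_P(f)) (v_P(ξ) + v_P(f)) ≥ d`. -/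
def tjAC (f : MvPowerSeries (Fin n) K) (d : ℕ) : Ideal (MvPowerSeries (Fin n) K) where
  carrier := {h | ∃ (g : MvPowerSeries (Fin n) K)
    (ξ : Derivation K (MvPowerSeries (Fin n) K) (MvPowerSeries (Fin n) K)),
    ((d : ℝ) : EReal) ≤ min (P.val g + P.val f) (P.derVal ξ + P.val f) ∧ h = g * f + ξ f}
  zero_mem' := by
    refine ⟨0, 0, ?_, by simp⟩
    have hf : P.val f ≠ ⊥ := by
      refine ne_bot_of_le_ne_bot (b := (0 : EReal)) (by simp) ?_
      exact P.le_val_iff.2 fun α _ => by exact_mod_cast P.expDeg_nonneg α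
    rw [val_zero, derVal_zero, EReal.top_add_of_ne_bot hf]
    simp
  add_mem' := by
    rintro _ _ ⟨g, ξ, h, rfl⟩ ⟨g', ξ', h', rfl⟩
    refine ⟨g + g', ξ + ξ', ?_, by rw [Derivation.add_apply]; ring⟩
    rw [le_min_iff] at h h' ⊢
    constructor
    · refine le_trans ?_ (add_le_add_left (P.min_le_val_add g g') _)
      rcases min_choice (P.val g) (P.val g') with e | e <;> rw [e]
      exacts [h.1, h'.1]
    · refine le_trans ?_ (add_le_add_left (P.min_le_derVal_add ξ ξ') _)
      rcases min_choice (P.derVal ξ) (P.derVal ξ') with e | e <;> rw [e]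
      exacts [h.2, h'.2]
  smul_mem' := by
    rintro c _ ⟨g, ξ, h, rfl⟩
    refine ⟨c * g, c • ξ, ?_, by
      rw [Derivation.smul_apply]; simp only [smul_eq_mul]; ring⟩
    rw [le_min_iff] at h ⊢
    exact ⟨h.1.trans (add_le_add_left (P.val_le_val_mul c g) _),
      h.2.trans (add_le_add_left (P.derVal_le_derVal_smul c ξ) _)⟩

/-- The graded piece `F_d / (tj_P^{AC}(f)_d + F_{d+1})`. -/
abbrev GrPiece (f : MvPowerSeries (Fin n) K) (d : ℕ) : Type _ :=
  P.filt K d ⧸ Submodule.comap (P.filt K d).subtype (P.tjAC f d ⊔ P.filt K (d + 1))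

/-- `gr_P^{AC}(T_f)`, the direct sum of the graded pieces, as a `K`-vector space. -/
abbrev Gr (f : MvPowerSeries (Fin n) K) : Type _ := DirectSum ℕ (P.GrPiece f)

/-- The class of `x^α` in `gr_P^{AC}(T_f)`; it lies in degree `v_P(x^α)`. -/
def monClass (f : MvPowerSeries (Fin n) K) (α : Fin n →₀ ℕ) : P.Gr f :=
  DirectSum.of (P.GrPiece f) (P.monDeg α)
    (Submodule.Quotient.mk ⟨MvPowerSeries.monomial α 1, P.monomial_mem_filt α⟩)

/-- `{x^α | α ∈ Λ}` is a regular basis for `T_f`: the classes of these monomials form a basis of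
the `K`-vector space `gr_P^{AC}(T_f)`. -/
def IsRegularBasis (f : MvPowerSeries (Fin n) K) (Λ : Set (Fin n →₀ ℕ)) : Prop :=
  LinearIndependent K (fun α : Λ => P.monClass f α) ∧
    Submodule.span K (P.monClass f '' Λ) = ⊤

/-- The exponents `α ∈ Λ` with `deg x^α ≤ 2k - ord f + 2` and `v_P(x^α) ≥ v_P(f - In_P f)`.
The first inequality is written without subtraction; it never holds if `f = 0`. -/
def normalFormExponents (f : MvPowerSeries (Fin n) K) (Λ : Set (Fin n →₀ ℕ)) (k : ℕ) :
    Set (Fin n →₀ ℕ) :=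
  {α | α ∈ Λ ∧ (α.degree : ℕ∞) + f.order ≤ 2 * k + 2 ∧
    P.val (f - P.initialForm f) ≤ P.val (MvPowerSeries.monomial α (1 : K))}

end CPolytope

/-- The ideal `𝔪 = ⟨x₁, …, xₙ⟩`. -/
def maxIdeal (n : ℕ) (K : Type*) [Field K] : Ideal (MvPowerSeries (Fin n) K) :=
  Ideal.span (Set.range MvPowerSeries.X)

/-- The Jacobian ideal `j(f)`, generated by the partial derivatives of `f`. -/
def jac {n : ℕ} {K : Type*} [Field K] (f : MvPowerSeries (Fin n) K) :
    Ideal (MvPowerSeries (Fin n) K) :=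
  Ideal.span (Set.range fun i => MvPowerSeries.pderiv K i f)

/-- Contact equivalence: `f = u φ(g)` for an automorphism `φ` of the `K`-algebra of power series
and a unit `u`. -/
def ContactEquiv {n : ℕ} {K : Type*} [Field K] (f g : MvPowerSeries (Fin n) K) : Prop :=
  ∃ (φ : MvPowerSeries (Fin n) K ≃ₐ[K] MvPowerSeries (Fin n) K) (u : (MvPowerSeries (Fin n) K)ˣ),
    f = u * φ g

end SingNF

end

/-!
The piecewise degree `v_P` is the minimum of the finitely many weighted degrees with the natural
weight vectors `W = N_P • w`. A series lies in `F_d` iff it has `W`-order at least `d` for every such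
`W`, and a derivation of piecewise degree at least `e` raises every `W`-order by `e`. For one linear
weight the degree of a product of monomials is the sum of the degrees, which fails for `v_P`; so all
estimates are made for a single `W`. The main estimate is a first-order Taylor formula
(`IsTwistedDerivation.taylor`): if the endomorphisms `φ, φ'` differ on the variables by `D xᵢ`, where
the derivation `D` along `φ` has degree `e`, then `φ' h - φ h - D h` has order at least
`ord h + 2 e`. It involves no division and so holds in every characteristic. An endomorphism that is
the identity up to higher weight is an automorphism, by completeness (`bijective_of_sub_mem`).

Elimination. Let `v = v_P(f)` and let `In` be the initial form. Suppose that `f - In` has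
been normalised up to terms `h` of degree `d > v`. The regular basis gives
`h = ∑ c_α x^α + (g In + ξ In)` modulo `F_{d+1}`, with `g` and `ξ` of degree `d - v > 0`. The
substitution `xᵢ ↦ xᵢ - ξ xᵢ` and the unit `1 - g` remove `g In + ξ In` up to `F_{d+1}`, because
`f - In` has degree above `v` (`CPolytope.exists_contactEquiv_sub`). Finitely many steps reach a
remainder of arbitrarily high order (`CPolytope.exists_contactEquiv_mem_filt`).

Finite determinacy. If `𝔪^{k+2} ⊆ 𝔪 f + 𝔪² j(f)`, then every `g` that agrees with `f` up to degree
`2 k - ord f + 2` is contact equivalent to `f` (`contactEquiv_of_sub_mem`). The equation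
`g = (1 + a) f(x + b)` is solved for `a` and `b` by Newton steps: the error, pulled back by the
current automorphism, is a combination of `f` and its partial derivatives by the hypothesis, and the
corresponding correction leaves a quadratic error of higher order by the Taylor formula. This removes
the high-order remainder and all basis monomials beyond the determinacy bound.
-/

noncomputable section

namespace SingNF

open MvPowerSeries

variable {n : ℕ} {K : Type*} [Field K]

/-! ### Weighted order filtrations -/

variable (K) in
/-- The ideal of the power series all of whose monomials have weighted degree at least `c`,
for natural weights `W` of the variables. -/
def weightIdeal (W : Fin n → ℕ) (c : ℕ) : Ideal (MvPowerSeries (Fin n) K) where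
  carrier := {h | ∀ α, coeff α h ≠ 0 → c ≤ Finsupp.weight W α}
  zero_mem' := by simp
  add_mem' {f g} hf hg α h := by
    by_cases h0 : coeff α f = 0
    · exact hg α (by simpa [h0] using h)
    · exact hf α h0
  smul_mem' h g hg α H := by
    classical
    rw [smul_eq_mul, coeff_mul] at H
    obtain ⟨p, hp, h1⟩ := Finset.exists_ne_zero_of_sum_ne_zero H
    rw [← Finset.HasAntidiagonal.mem_antidiagonal.1 hp, map_add]
    exact (hg _ (right_ne_zero_of_mul h1)).trans (Nat.le_add_left _ _)

theorem mem_weightIdeal {W : Fin n → ℕ} {c : ℕ} {h : MvPowerSeries (Fin n) K} :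
    h ∈ weightIdeal K W c ↔ ∀ α, coeff α h ≠ 0 → c ≤ Finsupp.weight W α := Iff.rfl

theorem weightIdeal_anti (W : Fin n → ℕ) {c d : ℕ} (h : c ≤ d) :
    weightIdeal K W d ≤ weightIdeal K W c := fun _ hf α hα => h.trans (hf α hα)

theorem mul_mem_weightIdeal {W : Fin n → ℕ} {c d e : ℕ} {f g : MvPowerSeries (Fin n) K}
    (hf : f ∈ weightIdeal K W c) (hg : g ∈ weightIdeal K W d) (he : e ≤ c + d) :
    f * g ∈ weightIdeal K W e := by
  classical
  intro α H
  rw [coeff_mul] at H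
  obtain ⟨p, hp, h1⟩ := Finset.exists_ne_zero_of_sum_ne_zero H
  rw [← Finset.HasAntidiagonal.mem_antidiagonal.1 hp, map_add]
  exact he.trans (add_le_add (hf _ (left_ne_zero_of_mul h1)) (hg _ (right_ne_zero_of_mul h1)))

theorem monomial_mem_weightIdeal {W : Fin n → ℕ} {c : ℕ} {α : Fin n →₀ ℕ}
    (h : c ≤ Finsupp.weight W α) (a : K) : monomial α a ∈ weightIdeal K W c := by
  classical
  intro β hβ
  rw [coeff_monomial] at hβ
  by_cases e : β = α
  · rwa [e]
  · simp [e] at hβ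

theorem X_mem_weightIdeal (W : Fin n → ℕ) (i : Fin n) : X i ∈ weightIdeal K W (W i) :=
  monomial_mem_weightIdeal (by simp [Finsupp.weight_single]) 1

theorem weightIdeal_zero (W : Fin n → ℕ) : weightIdeal K W 0 = ⊤ :=
  top_unique fun _ _ _ _ => Nat.zero_le _

theorem eq_zero_of_forall_mem_weightIdeal {W : Fin n → ℕ} {h : MvPowerSeries (Fin n) K}
    (H : ∀ c, h ∈ weightIdeal K W c) : h = 0 := by
  ext α
  by_contra hα
  exact absurd (H (Finsupp.weight W α + 1) α hα) (by simp)

theorem constantCoeff_eq_zero_of_mem_weightIdeal {W : Fin n → ℕ} {c : ℕ}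
    {h : MvPowerSeries (Fin n) K} (H : h ∈ weightIdeal K W c) (hc : 0 < c) :
    constantCoeff h = 0 := by
  by_contra h0
  have := H 0 (by rwa [coeff_zero_eq_constantCoeff_apply])
  simp at this
  omega

theorem weightIdeal_one_le {W : Fin n → ℕ} (hW : ∀ i, 0 < W i) (c : ℕ) :
    weightIdeal K 1 c ≤ weightIdeal K W c := by
  intro h hh α hα
  refine (hh α hα).trans ?_
  simp only [Finsupp.weight_apply, Finsupp.sum, smul_eq_mul]
  exact Finset.sum_le_sum fun i _ => Nat.mul_le_mul_left _ (hW i)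

/-- A series of order above `c` is a combination of the variables with coefficients of order at
least `c`. -/
theorem exists_sum_X_mul {c : ℕ} {h : MvPowerSeries (Fin n) K} (hh : h ∈ weightIdeal K 1 (c + 1)) :
    ∃ q : Fin n → MvPowerSeries (Fin n) K, (∀ i, q i ∈ weightIdeal K 1 c) ∧
      h = ∑ i, X i * q i := by
  classical
  have hex : ∀ α : Fin n →₀ ℕ, ∃ i : Option (Fin n), α ≠ 0 → ∃ j, i = some j ∧ α j ≠ 0 := by
    intro α
    by_cases h0 : α = 0
    · exact ⟨none, fun h => absurd h0 h⟩
    · obtain ⟨j, hj⟩ := Finsupp.ne_iff.1 h0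
      exact ⟨some j, fun _ => ⟨j, rfl, hj⟩⟩
  choose ι hι using hex
  -- Each monomial of `h` is assigned to one variable that divides it.
  let p : Fin n → MvPowerSeries (Fin n) K := fun i α =>
    if ι α = some i ∧ α i ≠ 0 then coeff α h else 0
  have hp : ∀ i α, coeff α (p i) = if ι α = some i ∧ α i ≠ 0 then coeff α h else 0 :=
    fun _ _ => rfl
  have hdvd : ∀ i, (X i : MvPowerSeries (Fin n) K) ∣ p i := fun i =>
    X_dvd_iff.2 fun α hα => by simp [hp, hα]
  choose q hq using hdvd
  refine ⟨q, fun i α hα => ?_, ?_⟩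
  · have h1 : coeff (Finsupp.single i 1 + α) (p i) = coeff α (q i) := by
      rw [hq, X_def, coeff_add_monomial_mul, one_mul]
    rw [← h1, hp] at hα
    have h2 := hh (Finsupp.single i 1 + α) (by
      intro h0
      simp [h0] at hα)
    simp [Finsupp.weight_single] at h2
    omega
  · ext α
    simp only [← hq, map_sum, hp]
    by_cases h0 : α = 0
    · have : coeff α h = 0 := by
        by_contra hne
        have := hh α hne
        simp [h0] at this
      simp [this]
    · obtain ⟨j, hj, hj'⟩ := hι α h0
      rw [Finset.sum_eq_single j]
      · simp [hj, hj']
      · intro i _ hi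
        simp [hj, Ne.symm hi]
      · simp

theorem maxIdeal_le_weightIdeal_one : maxIdeal n K ≤ weightIdeal K 1 1 := by
  refine Ideal.span_le.2 ?_
  rintro _ ⟨i, rfl⟩
  exact X_mem_weightIdeal 1 i

theorem maxIdeal_pow (L : ℕ) : maxIdeal n K ^ L = weightIdeal K 1 L := by
  induction L with
  | zero => simp [weightIdeal_zero]
  | succ L ih =>
    refine le_antisymm ?_ fun h hh => ?_
    · rw [pow_succ, ih]
      exact Ideal.mul_le.2 fun a ha b hb =>
        mul_mem_weightIdeal ha (maxIdeal_le_weightIdeal_one hb) le_rfl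
    · obtain ⟨q, hq, rfl⟩ := exists_sum_X_mul hh
      refine Ideal.sum_mem _ fun i _ => ?_
      rw [pow_succ', ih]
      exact Ideal.mul_mem_mul (Ideal.subset_span ⟨i, rfl⟩) (hq i)

theorem mem_maxIdeal_iff {h : MvPowerSeries (Fin n) K} :
    h ∈ maxIdeal n K ↔ constantCoeff h = 0 := by
  rw [← pow_one (maxIdeal n K), maxIdeal_pow]
  refine ⟨fun H => constantCoeff_eq_zero_of_mem_weightIdeal H one_pos, fun H α hα => ?_⟩
  by_contra h0
  have : α = 0 := by
    have h1 : Finsupp.weight (1 : Fin n → ℕ) α = 0 := by omega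
    have h2 : Finsupp.degree α = 0 := by
      rw [Finsupp.degree_eq_weight_one]
      exact h1
    exact (Finsupp.degree_eq_zero_iff α).1 h2
  subst this
  exact hα (by rwa [coeff_zero_eq_constantCoeff_apply])

theorem weightIdeal_le_maxIdeal {W : Fin n → ℕ} {c : ℕ} (hc : 0 < c) :
    weightIdeal K W c ≤ maxIdeal n K := fun _ hh =>
  mem_maxIdeal_iff.2 (constantCoeff_eq_zero_of_mem_weightIdeal hh hc)

/-- Completeness: a sequence whose successive differences have growing weighted order converges. -/
theorem exists_limit {W : Fin n → ℕ} (c : ℕ) (u : ℕ → MvPowerSeries (Fin n) K)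
    (hu : ∀ j, u (j + 1) - u j ∈ weightIdeal K W (c + j)) :
    ∃ v, ∀ j, v - u j ∈ weightIdeal K W (c + j) := by
  have hmono : ∀ j m, u (j + m) - u j ∈ weightIdeal K W (c + j) := by
    intro j m
    induction m with
    | zero => simp
    | succ m ih =>
      have h1 := weightIdeal_anti W (by omega : c + j ≤ c + (j + m)) (hu (j + m))
      have := Ideal.add_mem _ h1 ih
      rwa [sub_add_sub_cancel] at this
  let v : MvPowerSeries (Fin n) K := fun α => coeff α (u (Finsupp.weight W α + 1))
  refine ⟨v, fun j α hα => ?_⟩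
  by_contra hlt
  -- The `α`-coefficient of `u j` is constant once `c + j` exceeds the weight of `α`.
  obtain ⟨m, hm⟩ : ∃ m, j = (Finsupp.weight W α + 1) + m ∨ Finsupp.weight W α + 1 = j + m := by
    rcases le_total j (Finsupp.weight W α + 1) with h | h
    · exact ⟨_, Or.inr (Nat.add_sub_of_le h).symm⟩
    · exact ⟨_, Or.inl (Nat.add_sub_of_le h).symm⟩
  rw [map_sub] at hα
  change coeff α (u (Finsupp.weight W α + 1)) - _ ≠ 0 at hα
  rcases hm with hm | hm
  · have h1 := hmono (Finsupp.weight W α + 1) m α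
    rw [map_sub, ← hm] at h1
    have := h1 (by rwa [← neg_sub, neg_ne_zero])
    omega
  · have h1 := hmono j m α
    rw [map_sub, ← hm] at h1
    exact hlt (h1 hα)

/-! ### Linear maps, endomorphisms and twisted derivations -/

/-- A linear map that is continuous for the `𝔪`-adic topology takes `h` into `F_c` as soon as it
does so with every monomial of `h`. -/
theorem map_mem_weightIdeal_of_monomial {W : Fin n → ℕ} {c : ℕ}
    (T : MvPowerSeries (Fin n) K →ₗ[K] MvPowerSeries (Fin n) K)
    (hT : ∃ L, ∀ h ∈ maxIdeal n K ^ L, T h ∈ weightIdeal K W c)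
    {h : MvPowerSeries (Fin n) K}
    (hmon : ∀ α, coeff α h ≠ 0 → T (monomial α 1) ∈ weightIdeal K W c) :
    T h ∈ weightIdeal K W c := by
  classical
  obtain ⟨L, hL⟩ := hT
  set s := (Finsupp.finite_of_degree_le (σ := Fin n) L).toFinset with hs
  have htail : h - ∑ α ∈ s, monomial α (coeff α h) ∈ maxIdeal n K ^ L := by
    rw [maxIdeal_pow]
    intro β hβ
    by_contra hlt
    have hmem : β ∈ s := by
      have : Finsupp.degree β = Finsupp.weight (1 : Fin n → ℕ) β := by
        rw [Finsupp.degree_eq_weight_one]; rfl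
      simp only [hs, Set.Finite.mem_toFinset, Set.mem_ofPred_eq]
      omega
    refine hβ ?_
    rw [map_sub, map_sum, Finset.sum_eq_single β]
    · simp
    · intro α _ hα
      rw [coeff_monomial, if_neg hα.symm]
    · exact fun h => absurd hmem h
  have h1 := hL _ htail
  rw [map_sub, map_sum] at h1
  have h2 : ∑ α ∈ s, T (monomial α (coeff α h)) ∈ weightIdeal K W c := by
    refine Ideal.sum_mem _ fun α _ => ?_
    by_cases h0 : coeff α h = 0
    · simp [h0]
    · have : monomial α (coeff α h) = (coeff α h) • monomial α (1 : K) := by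
        rw [← map_smul, smul_eq_mul, mul_one]
      rw [this, map_smul]
      exact Submodule.smul_of_tower_mem _ _ (hmon α h0)
  simpa using Ideal.add_mem _ h1 h2

theorem exponent_induction {p : (Fin n →₀ ℕ) → Prop} (h0 : p 0)
    (h1 : ∀ i, p (Finsupp.single i 1)) (hadd : ∀ α β, p α → p β → p (α + β)) (α) : p α := by
  induction α using Finsupp.induction_linear with
  | zero => exact h0
  | add α β ha hb => exact hadd α β ha hb
  | single i m =>
    induction m with
    | zero => simpa using h0
    | succ m ih => rw [Finsupp.single_add]; exact hadd _ _ ih (h1 i)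

theorem monomial_add_eq (α β : Fin n →₀ ℕ) :
    (monomial (α + β) 1 : MvPowerSeries (Fin n) K) = monomial α 1 * monomial β 1 := by
  rw [monomial_mul_monomial, one_mul]

theorem algHom_maxIdeal_pow {φ : MvPowerSeries (Fin n) K →ₐ[K] MvPowerSeries (Fin n) K}
    (hφ : ∀ i, φ (X i) ∈ maxIdeal n K) {L : ℕ} {h : MvPowerSeries (Fin n) K}
    (hh : h ∈ maxIdeal n K ^ L) : φ h ∈ maxIdeal n K ^ L := by
  have h1 : (maxIdeal n K).map φ ≤ maxIdeal n K := by
    rw [maxIdeal, Ideal.map_span, Ideal.span_le]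
    rintro _ ⟨_, ⟨i, rfl⟩, rfl⟩
    exact hφ i
  have h2 := Ideal.mem_map_of_mem φ hh
  rw [Ideal.map_pow] at h2
  exact Ideal.pow_right_mono h1 L h2

theorem algHom_mem_weightIdeal {W : Fin n → ℕ} (hW : ∀ i, 0 < W i)
    {φ : MvPowerSeries (Fin n) K →ₐ[K] MvPowerSeries (Fin n) K}
    (hφ : ∀ i, φ (X i) ∈ weightIdeal K W (W i)) {c : ℕ} {h : MvPowerSeries (Fin n) K}
    (hh : h ∈ weightIdeal K W c) : φ h ∈ weightIdeal K W c := by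
  have hmon : ∀ α, φ (monomial α 1) ∈ weightIdeal K W (Finsupp.weight W α) := by
    refine exponent_induction (by simp [weightIdeal_zero]) (fun i => ?_) fun α β ha hb => ?_
    · simpa [Finsupp.weight_single, X_def] using hφ i
    · rw [monomial_add_eq, map_mul]
      exact mul_mem_weightIdeal ha hb (by simp)
  refine map_mem_weightIdeal_of_monomial φ.toLinearMap ⟨c, fun g hg => ?_⟩
    fun α hα => weightIdeal_anti W (hh α hα) (hmon α)
  have := algHom_maxIdeal_pow (fun i => weightIdeal_le_maxIdeal (hW i) (hφ i)) hg
  rw [maxIdeal_pow] at this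
  exact weightIdeal_one_le hW c this

/-- A linear map `D` with the twisted Leibniz rule `D (g h) = φ' h * D g + φ g * D h`. Both a
derivation along `φ` (where `φ' = φ`) and a difference `φ' - φ` are of this kind. -/
def IsTwistedDerivation (φ φ' : MvPowerSeries (Fin n) K →ₐ[K] MvPowerSeries (Fin n) K)
    (D : MvPowerSeries (Fin n) K →ₗ[K] MvPowerSeries (Fin n) K) : Prop :=
  ∀ g h, D (g * h) = φ' h * D g + φ g * D h

namespace IsTwistedDerivation

variable {φ φ' : MvPowerSeries (Fin n) K →ₐ[K] MvPowerSeries (Fin n) K}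
  {D : MvPowerSeries (Fin n) K →ₗ[K] MvPowerSeries (Fin n) K}

theorem map_one_eq_zero (hD : IsTwistedDerivation φ φ' D) : D 1 = 0 := by
  have := hD 1 1
  simpa using this

theorem mem_maxIdeal_pow (hD : IsTwistedDerivation φ φ' D)
    (hφ : ∀ i, φ (X i) ∈ maxIdeal n K) (hφ' : ∀ i, φ' (X i) ∈ maxIdeal n K) (L : ℕ) :
    ∀ h ∈ maxIdeal n K ^ (L + 1), D h ∈ maxIdeal n K ^ L := by
  induction L with
  | zero => simp
  | succ L ih =>
    intro h hh
    rw [pow_succ] at hh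
    refine Submodule.mul_induction_on hh (fun a ha b hb => ?_) fun a b ha hb => ?_
    · rw [hD]
      refine Ideal.add_mem _ ?_ ?_
      · rw [pow_succ']
        rw [← pow_one (maxIdeal n K)] at hb
        have := algHom_maxIdeal_pow hφ' hb
        rw [pow_one] at this
        exact Ideal.mul_mem_mul this (ih a ha)
      · exact Ideal.mul_mem_right _ _ (algHom_maxIdeal_pow hφ ha)
    · rw [map_add]
      exact Ideal.add_mem _ ha hb

theorem mem_weightIdeal (hD : IsTwistedDerivation φ φ' D) {W : Fin n → ℕ} (hW : ∀ i, 0 < W i)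
    (hφ : ∀ i, φ (X i) ∈ weightIdeal K W (W i)) (hφ' : ∀ i, φ' (X i) ∈ weightIdeal K W (W i))
    {e : ℕ} (hX : ∀ i, D (X i) ∈ weightIdeal K W (W i + e)) {c : ℕ}
    {h : MvPowerSeries (Fin n) K} (hh : h ∈ weightIdeal K W c) :
    D h ∈ weightIdeal K W (c + e) := by
  have hmon : ∀ α, D (monomial α 1) ∈ weightIdeal K W (Finsupp.weight W α + e) := by
    refine exponent_induction ?_ (fun i => ?_) fun α β ha hb => ?_
    · simpa using by rw [hD.map_one_eq_zero]; exact Ideal.zero_mem _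
    · simpa [Finsupp.weight_single, X_def] using hX i
    · rw [monomial_add_eq, hD]
      have hα := algHom_mem_weightIdeal hW hφ (monomial_mem_weightIdeal (le_refl
        (Finsupp.weight W α)) (1 : K))
      have hβ := algHom_mem_weightIdeal hW hφ' (monomial_mem_weightIdeal (le_refl
        (Finsupp.weight W β)) (1 : K))
      exact Ideal.add_mem _ (mul_mem_weightIdeal hβ ha (by simp; omega))
        (mul_mem_weightIdeal hα hb (by simp; omega))
  refine map_mem_weightIdeal_of_monomial D ⟨c + e + 1, fun g hg => ?_⟩
    fun α hα => weightIdeal_anti W (by have := hh α hα; omega) (hmon α)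
  have := hD.mem_maxIdeal_pow (fun i => weightIdeal_le_maxIdeal (hW i) (hφ i))
    (fun i => weightIdeal_le_maxIdeal (hW i) (hφ' i)) _ g hg
  rw [maxIdeal_pow] at this
  exact weightIdeal_one_le hW _ this

theorem algHom_sub_algHom (φ φ' : MvPowerSeries (Fin n) K →ₐ[K] MvPowerSeries (Fin n) K) :
    IsTwistedDerivation φ φ' (φ'.toLinearMap - φ.toLinearMap) := by
  intro g h
  simp only [LinearMap.sub_apply, AlgHom.toLinearMap_apply, map_mul]
  ring

/-- First-order Taylor formula with weighted remainder: if `D` is the derivation along `φ` with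
`D xᵢ = φ' xᵢ - φ xᵢ` of weight `e`, then `φ' - φ - D` raises weights by `2 e`. -/
theorem taylor (hD : IsTwistedDerivation φ φ D) {W : Fin n → ℕ} (hW : ∀ i, 0 < W i)
    (hφ : ∀ i, φ (X i) ∈ weightIdeal K W (W i)) (hφ' : ∀ i, φ' (X i) ∈ weightIdeal K W (W i))
    {e : ℕ} (hX : ∀ i, D (X i) ∈ weightIdeal K W (W i + e))
    (hDX : ∀ i, D (X i) = φ' (X i) - φ (X i)) {c : ℕ}
    {h : MvPowerSeries (Fin n) K} (hh : h ∈ weightIdeal K W c) :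
    φ' h - φ h - D h ∈ weightIdeal K W (c + 2 * e) := by
  have hmon : ∀ α, φ' (monomial α 1) - φ (monomial α 1) - D (monomial α 1) ∈
      weightIdeal K W (Finsupp.weight W α + 2 * e) := by
    refine exponent_induction ?_ (fun i => ?_) fun α β ha hb => ?_
    · have : (monomial 0 1 : MvPowerSeries (Fin n) K) = 1 := rfl
      rw [this, hD.map_one_eq_zero]
      simp
    · change φ' (X i) - φ (X i) - D (X i) ∈ _
      rw [hDX, sub_self]
      exact Ideal.zero_mem _
    · have hα := monomial_mem_weightIdeal (le_refl (Finsupp.weight W α)) (1 : K)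
      have hβ := monomial_mem_weightIdeal (le_refl (Finsupp.weight W β)) (1 : K)
      have hd := (algHom_sub_algHom φ φ').mem_weightIdeal hW hφ hφ'
        (fun i => by simpa [← hDX] using hX i) hβ
      have hDα := hD.mem_weightIdeal hW hφ hφ hX hα
      have key : φ' (monomial (α + β) 1) - φ (monomial (α + β) 1) - D (monomial (α + β) 1) =
          (φ' (monomial α 1) - φ (monomial α 1) - D (monomial α 1)) * φ' (monomial β 1) +
          φ (monomial α 1) * (φ' (monomial β 1) - φ (monomial β 1) - D (monomial β 1)) +
          D (monomial α 1) * (φ'.toLinearMap - φ.toLinearMap) (monomial β 1) := by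
        rw [monomial_add_eq, hD]
        simp only [LinearMap.sub_apply, AlgHom.toLinearMap_apply, map_mul]
        ring
      rw [key]
      refine Ideal.add_mem _ (Ideal.add_mem _ ?_ ?_) ?_
      · exact mul_mem_weightIdeal ha (algHom_mem_weightIdeal hW hφ' hβ) (by simp; omega)
      · exact mul_mem_weightIdeal (algHom_mem_weightIdeal hW hφ hα) hb (by simp; omega)
      · exact mul_mem_weightIdeal hDα hd (by simp; omega)
  have hm := fun i => weightIdeal_le_maxIdeal (hW i) (hφ i)
  have hm' := fun i => weightIdeal_le_maxIdeal (hW i) (hφ' i)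
  refine map_mem_weightIdeal_of_monomial (φ'.toLinearMap - φ.toLinearMap - D)
    ⟨c + 2 * e + 1, fun g hg => ?_⟩
    fun α hα => weightIdeal_anti W (by have := hh α hα; omega) (hmon α)
  have hg' := Ideal.pow_le_pow_right (Nat.le_succ _) hg
  have := Ideal.sub_mem _ (Ideal.sub_mem _ (algHom_maxIdeal_pow hm' hg')
    (algHom_maxIdeal_pow hm hg')) (hD.mem_maxIdeal_pow hm hm _ g hg)
  rw [maxIdeal_pow] at this
  exact weightIdeal_one_le hW _ this

end IsTwistedDerivation

/-- Close algebra endomorphisms take close values. -/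
theorem algHom_sub_mem {W : Fin n → ℕ} (hW : ∀ i, 0 < W i)
    {φ φ' : MvPowerSeries (Fin n) K →ₐ[K] MvPowerSeries (Fin n) K}
    (hφ : ∀ i, φ (X i) ∈ weightIdeal K W (W i)) {e : ℕ}
    (hX : ∀ i, φ' (X i) - φ (X i) ∈ weightIdeal K W (W i + e)) {c : ℕ}
    {h : MvPowerSeries (Fin n) K} (hh : h ∈ weightIdeal K W c) :
    φ' h - φ h ∈ weightIdeal K W (c + e) :=
  (IsTwistedDerivation.algHom_sub_algHom φ φ').mem_weightIdeal hW hφ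
    (fun i => by
      have := Ideal.add_mem _ (weightIdeal_anti W (Nat.le_add_right _ _) (hX i)) (hφ i)
      rwa [sub_add_cancel] at this) hX hh

/-! ### Automorphisms tangent to the identity -/

theorem algHom_sub_self_mem {W : Fin n → ℕ} (hW : ∀ i, 0 < W i)
    {φ : MvPowerSeries (Fin n) K →ₐ[K] MvPowerSeries (Fin n) K}
    (hφ : ∀ i, φ (X i) - X i ∈ weightIdeal K W (W i + 1))
    {c : ℕ} {h : MvPowerSeries (Fin n) K} (hh : h ∈ weightIdeal K W c) :
    φ h - h ∈ weightIdeal K W (c + 1) :=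
  algHom_sub_mem (φ := AlgHom.id K _) hW (X_mem_weightIdeal W) hφ hh

theorem mem_weightIdeal_of_algHom_mem {W : Fin n → ℕ} (hW : ∀ i, 0 < W i)
    {φ : MvPowerSeries (Fin n) K →ₐ[K] MvPowerSeries (Fin n) K}
    (hφ : ∀ i, φ (X i) - X i ∈ weightIdeal K W (W i + 1))
    {c : ℕ} {h : MvPowerSeries (Fin n) K}
    (hh : φ h ∈ weightIdeal K W c) : h ∈ weightIdeal K W c := by
  have : ∀ d ≤ c, h ∈ weightIdeal K W d := by
    intro d
    induction d with
    | zero => simp [weightIdeal_zero]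
    | succ d ih =>
      intro hd
      have h1 := algHom_sub_self_mem hW hφ (ih (by omega))
      have := Ideal.sub_mem _ (weightIdeal_anti W hd hh) h1
      rwa [sub_sub_cancel] at this
  exact this c le_rfl

/-- An endomorphism that is the identity up to terms of higher weight is bijective, since the
weight filtration is separated and complete. -/
theorem bijective_of_sub_mem {W : Fin n → ℕ} (hW : ∀ i, 0 < W i)
    {φ : MvPowerSeries (Fin n) K →ₐ[K] MvPowerSeries (Fin n) K}
    (hφ : ∀ i, φ (X i) - X i ∈ weightIdeal K W (W i + 1)) :
    Function.Bijective φ := by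
  constructor
  · refine (injective_iff_map_eq_zero φ).2 fun h hh => ?_
    refine eq_zero_of_forall_mem_weightIdeal (W := W) fun c =>
      mem_weightIdeal_of_algHom_mem hW hφ ?_
    rw [hh]
    exact Ideal.zero_mem _
  · intro g
    -- Successive approximation: the error `g - φ h` is added to `h`.
    let u : ℕ → MvPowerSeries (Fin n) K := fun j => Nat.rec 0 (fun _ h => h + (g - φ h)) j
    have hu : ∀ j, u (j + 1) = u j + (g - φ (u j)) := fun _ => rfl
    have h1 : ∀ j, g - φ (u j) ∈ weightIdeal K W j := by
      intro j
      induction j with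
      | zero => simp [weightIdeal_zero]
      | succ j ih =>
        have := Ideal.neg_mem_iff _ |>.2 (algHom_sub_self_mem hW hφ ih)
        rw [hu, map_add]
        convert this using 1
        ring
    obtain ⟨v, hv⟩ := exists_limit (W := W) 0 u fun j => by
      rw [hu, add_sub_cancel_left, zero_add]
      exact h1 j
    refine ⟨v, (sub_eq_zero.1 (eq_zero_of_forall_mem_weightIdeal (W := W) fun j => ?_)).symm⟩
    have hid : ∀ i, φ (X i) ∈ weightIdeal K W (W i) := fun i => by
      have := Ideal.add_mem _ (weightIdeal_anti W (Nat.le_add_right _ _) (hφ i))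
        (X_mem_weightIdeal W i)
      rwa [sub_add_cancel] at this
    have h2 := algHom_mem_weightIdeal hW hid (hv j)
    rw [zero_add] at h2
    have := Ideal.sub_mem _ (h1 j) h2
    rw [map_sub] at this
    convert this using 1
    ring

/-- The substitution `xᵢ ↦ xᵢ + bᵢ`, for `bᵢ` without constant term. -/
theorem exists_algHom_X_add (b : Fin n → MvPowerSeries (Fin n) K) :
    ∃ φ : MvPowerSeries (Fin n) K →ₐ[K] MvPowerSeries (Fin n) K,
      (∀ i, constantCoeff (b i) = 0) → ∀ i, φ (X i) = X i + b i := by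
  by_cases hb : ∀ i, constantCoeff (b i) = 0
  · have h : HasSubst (fun i => X i + b i) :=
      hasSubst_of_constantCoeff_zero fun i => by simp [hb]
    exact ⟨substAlgHom h, fun _ i => substAlgHom_X h i⟩
  · exact ⟨AlgHom.id K _, fun h => absurd h hb⟩

theorem isUnit_one_add {W : Fin n → ℕ} {c : ℕ} (hc : 0 < c) {a : MvPowerSeries (Fin n) K}
    (ha : a ∈ weightIdeal K W c) : IsUnit (1 + a) := by
  rw [isUnit_iff_constantCoeff, map_add, map_one,
    constantCoeff_eq_zero_of_mem_weightIdeal ha hc, add_zero]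
  exact isUnit_one

/-! ### Finite determinacy for contact equivalence -/

theorem pderiv_mem_weightIdeal_one {c : ℕ} {f : MvPowerSeries (Fin n) K}
    (hf : f ∈ weightIdeal K 1 c) (i : Fin n) : pderiv K i f ∈ weightIdeal K 1 (c - 1) := by
  cases c with
  | zero => simp [weightIdeal_zero]
  | succ c =>
    have hD : IsTwistedDerivation (AlgHom.id K _) (AlgHom.id K _)
        (pderiv K i : MvPowerSeries (Fin n) K →ₗ[K] MvPowerSeries (Fin n) K) := by
      intro g h
      simp only [Derivation.coeFn_coe, Derivation.leibniz, smul_eq_mul, AlgHom.coe_id, id]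
      ring
    have hX : ∀ j, AlgHom.id K (MvPowerSeries (Fin n) K) (X j) ∈ maxIdeal n K :=
      fun j => Ideal.subset_span ⟨j, rfl⟩
    rw [← maxIdeal_pow] at hf ⊢
    exact hD.mem_maxIdeal_pow hX hX c f hf

theorem maxIdeal_mul_span_add_le {c : ℕ} (hc : 1 ≤ c) {f : MvPowerSeries (Fin n) K}
    (hf : f ∈ weightIdeal K 1 c) :
    maxIdeal n K * Ideal.span {f} + maxIdeal n K ^ 2 * jac f ≤ weightIdeal K 1 (c + 1) := by
  have hj : jac f ≤ weightIdeal K 1 (c - 1) := by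
    refine Ideal.span_le.2 ?_
    rintro _ ⟨i, rfl⟩
    exact pderiv_mem_weightIdeal_one hf i
  refine sup_le (Ideal.mul_le.2 fun a ha b hb => ?_) (Ideal.mul_le.2 fun a ha b hb => ?_)
  · have : b ∈ weightIdeal K 1 c := (Ideal.span_singleton_le_iff_mem _).2 hf hb
    exact mul_mem_weightIdeal (maxIdeal_le_weightIdeal_one ha) this (by omega)
  · rw [maxIdeal_pow] at ha
    exact mul_mem_weightIdeal ha (hj hb) (by omega)

/-- The hypothesis of finite determinacy bounds the order of `f`. -/
theorem le_of_mem_weightIdeal_one (hn : 1 ≤ n) {f : MvPowerSeries (Fin n) K} {k c : ℕ} (hc : 1 ≤ c)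
    (hk : maxIdeal n K ^ (k + 2) ≤
      maxIdeal n K * Ideal.span {f} + maxIdeal n K ^ 2 * jac f)
    (hf : f ∈ weightIdeal K 1 c) : c ≤ k + 1 := by
  let i : Fin n := ⟨0, hn⟩
  have hX : (X i : MvPowerSeries (Fin n) K) ^ (k + 2) ∈ maxIdeal n K ^ (k + 2) :=
    Ideal.pow_mem_pow (I := maxIdeal n K) (Ideal.subset_span ⟨i, rfl⟩) _
  have h1 := maxIdeal_mul_span_add_le hc hf (hk hX)
  rw [X_pow_eq] at h1
  have := h1 (Finsupp.single i (k + 2)) (by simp)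
  simp [Finsupp.weight_single] at this
  omega

/-- The hypothesis of finite determinacy, multiplied by `𝔪 ^ s`. -/
theorem exists_eq_mul_add_sum_pderiv {f : MvPowerSeries (Fin n) K} {k : ℕ}
    (hk : maxIdeal n K ^ (k + 2) ≤
      maxIdeal n K * Ideal.span {f} + maxIdeal n K ^ 2 * jac f)
    {s : ℕ} {h : MvPowerSeries (Fin n) K} (hh : h ∈ weightIdeal K 1 (k + 2 + s)) :
    ∃ a ∈ weightIdeal K 1 (s + 1), ∃ b : Fin n → MvPowerSeries (Fin n) K,
      (∀ i, b i ∈ weightIdeal K 1 (s + 2)) ∧ h = a * f + ∑ i, b i * pderiv K i f := by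
  have h1 : h ∈ maxIdeal n K ^ (s + 1) * Ideal.span {f} + maxIdeal n K ^ (s + 2) * jac f := by
    rw [← maxIdeal_pow, add_comm, pow_add] at hh
    have := Ideal.mul_mono_right (I := maxIdeal n K ^ s) hk hh
    rw [Ideal.add_eq_sup, Ideal.mul_sup] at this
    rwa [Ideal.add_eq_sup, pow_succ, mul_assoc, pow_add (maxIdeal n K) s 2, mul_assoc]
  obtain ⟨y, hy, z, hz, rfl⟩ := Submodule.mem_sup.1 h1
  rw [maxIdeal_pow] at hy hz
  obtain ⟨a, ha, rfl⟩ := Ideal.mem_mul_span_singleton.1 hy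
  obtain ⟨b, hb, rfl⟩ := (Submodule.mem_ideal_smul_span_iff_exists_sum _ _ _).1 hz
  refine ⟨a, ha, fun i => b i, hb, ?_⟩
  rw [Finsupp.sum_fintype _ _ (by simp)]
  simp

/-- Iteration of a step that preserves an invariant. -/
theorem exists_seq_of_step {α : Type*} (Q : ℕ → α → Prop) (R : ℕ → α → α → Prop) {x₀ : α}
    (h0 : Q 0 x₀) (hstep : ∀ j x, Q j x → ∃ y, Q (j + 1) y ∧ R j x y) :
    ∃ u : ℕ → α, ∀ j, Q j (u j) ∧ R j (u j) (u (j + 1)) := by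
  choose! F hF using hstep
  let u : ℕ → α := fun j => Nat.rec x₀ F j
  have hu : ∀ j, Q j (u j) := by
    intro j
    induction j with
    | zero => exact h0
    | succ j ih => exact (hF j _ ih).1
  exact ⟨u, fun j => ⟨hu j, (hF j _ (hu j)).2⟩⟩

/-- One Newton step for the equation `(1 + a) f(x + b) = g`; `Φ b` is the substitution
`xᵢ ↦ xᵢ + bᵢ`. Corrections `δa`, `δb` of orders `s + 1 + j` and `s + 2 + j` leave an error of order
`o + 2 (s + 1 + j)`, which is at least `k + 2 + s + (j + 1)`. -/
theorem newton_step {f g : MvPowerSeries (Fin n) K} {k o s : ℕ}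
    (hf : f ∈ weightIdeal K 1 o) (hko : k + 1 = o + s)
    (hk : maxIdeal n K ^ (k + 2) ≤
      maxIdeal n K * Ideal.span {f} + maxIdeal n K ^ 2 * jac f)
    (Φ : (Fin n → MvPowerSeries (Fin n) K) →
      MvPowerSeries (Fin n) K →ₐ[K] MvPowerSeries (Fin n) K)
    (hΦ : ∀ b : Fin n → MvPowerSeries (Fin n) K, (∀ i, b i ∈ weightIdeal K 1 2) →
      ∀ i, Φ b (X i) = X i + b i)
    (j : ℕ) {a : MvPowerSeries (Fin n) K} {b : Fin n → MvPowerSeries (Fin n) K}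
    (ha : a ∈ weightIdeal K 1 1) (hb : ∀ i, b i ∈ weightIdeal K 1 2)
    (hr : g - (1 + a) * Φ b f ∈ weightIdeal K 1 (k + 2 + s + j)) :
    ∃ (a' : MvPowerSeries (Fin n) K) (b' : Fin n → MvPowerSeries (Fin n) K),
      (a' ∈ weightIdeal K 1 1 ∧ (∀ i, b' i ∈ weightIdeal K 1 2) ∧
        g - (1 + a') * Φ b' f ∈ weightIdeal K 1 (k + 2 + s + (j + 1))) ∧
      a' - a ∈ weightIdeal K 1 (s + 1 + j) ∧ ∀ i, b' i - b i ∈ weightIdeal K 1 (s + 2 + j) := by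
  have hW : ∀ i, 0 < (1 : Fin n → ℕ) i := fun _ => one_pos
  set φ := Φ b with hφdef
  have hφ2 : ∀ i, φ (X i) - X i ∈ weightIdeal K (1 : Fin n → ℕ) ((1 : Fin n → ℕ) i + 1) :=
    fun i => by
      rw [hφdef, hΦ b hb, add_sub_cancel_left]
      exact hb i
  have hφ1 : ∀ i, φ (X i) ∈ weightIdeal K (1 : Fin n → ℕ) ((1 : Fin n → ℕ) i) := fun i => by
    have := Ideal.add_mem _ (weightIdeal_anti 1 (Nat.le_add_right _ _) (hφ2 i))
      (X_mem_weightIdeal 1 i)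
    rwa [sub_add_cancel] at this
  -- Pull the error back by `φ`, decompose it there, and push the decomposition forward.
  obtain ⟨r, hrφ⟩ := (bijective_of_sub_mem hW hφ2).2 (g - (1 + a) * φ f)
  rw [add_assoc, ← hrφ] at hr
  obtain ⟨α, hα, β, hβ, hrαβ⟩ :=
    exists_eq_mul_add_sum_pderiv hk (mem_weightIdeal_of_algHom_mem hW hφ2 hr)
  obtain ⟨u, hu⟩ := isUnit_one_add one_pos ha
  let δ : Fin n → MvPowerSeries (Fin n) K := fun i => ↑u⁻¹ * φ (β i)
  have hα' : φ α ∈ weightIdeal K 1 (s + 1 + j) :=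
    algHom_mem_weightIdeal hW hφ1 (weightIdeal_anti 1 (by omega) hα)
  have hδ : ∀ i, δ i ∈ weightIdeal K 1 (s + 2 + j) := fun i =>
    Ideal.mul_mem_left _ _
      (algHom_mem_weightIdeal hW hφ1 (weightIdeal_anti 1 (by omega) (hβ i)))
  have hb' : ∀ i, b i + δ i ∈ weightIdeal K 1 2 := fun i =>
    Ideal.add_mem _ (hb i) (weightIdeal_anti 1 (by omega) (hδ i))
  let D : MvPowerSeries (Fin n) K →ₗ[K] MvPowerSeries (Fin n) K :=
    ∑ i, LinearMap.mulLeft K (δ i) ∘ₗ φ.toLinearMap ∘ₗ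
      (pderiv K i : MvPowerSeries (Fin n) K →ₗ[K] MvPowerSeries (Fin n) K)
  have hDapp : ∀ h, D h = ∑ i, δ i * φ (pderiv K i h) := fun h => by
    simp [D, LinearMap.sum_apply]
  have hD : IsTwistedDerivation φ φ D := fun g h => by
    simp only [hDapp, Derivation.leibniz, smul_eq_mul, map_add, map_mul, Finset.mul_sum,
      ← Finset.sum_add_distrib]
    exact Finset.sum_congr rfl fun i _ => by ring
  have hDX : ∀ i, D (X i) = δ i := fun i => by
    classical
    rw [hDapp, Finset.sum_eq_single i]
    · simp
    · intro j _ hj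
      simp [pderiv_X_of_ne hj.symm]
    · simp
  set φ' := Φ fun i => b i + δ i with hφ'def
  have hφ' : ∀ i, φ' (X i) - φ (X i) = δ i := fun i => by
    rw [hφ'def, hΦ _ hb', hφdef, hΦ _ hb]
    ring
  have hφ'1 : ∀ i, φ' (X i) ∈ weightIdeal K (1 : Fin n → ℕ) ((1 : Fin n → ℕ) i) := fun i => by
    have := Ideal.add_mem _ (weightIdeal_anti 1 (c := 1) (by omega) (hδ i)) (hφ1 i)
    rwa [← hφ', sub_add_cancel] at this
  have hXe : ∀ i, D (X i) ∈ weightIdeal K 1 ((1 : Fin n → ℕ) i + (s + 1 + j)) := fun i => by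
    rw [hDX]
    exact weightIdeal_anti 1 (by simp; omega) (hδ i)
  have hT := hD.taylor hW hφ1 hφ'1 hXe (fun i => by rw [hDX, hφ']) hf
  have hd := algHom_sub_mem hW hφ1 (fun i => by rw [hφ', ← hDX]; exact hXe i) hf
  refine ⟨a + φ α, fun i => b i + δ i, ⟨Ideal.add_mem _ ha (weightIdeal_anti 1 (by omega) hα'),
    hb', ?_⟩, by simpa using hα', fun i => by simpa using hδ i⟩
  have hfirst : g - (1 + a) * φ f = φ α * φ f + (1 + a) * D f := by
    rw [← hrφ, hrαβ, hDapp, Finset.mul_sum, map_add, map_mul, map_sum]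
    congr 1
    refine Finset.sum_congr rfl fun i _ => ?_
    rw [map_mul, ← hu]
    simp [δ, ← mul_assoc]
  have key : g - (1 + (a + φ α)) * φ' f =
      -((1 + a) * (φ' f - φ f - D f) + φ α * (φ' f - φ f)) := by
    linear_combination hfirst
  rw [key]
  refine (Ideal.neg_mem_iff _).2 (Ideal.add_mem _ ?_ ?_)
  · exact Ideal.mul_mem_left _ _ (weightIdeal_anti 1 (by omega) hT)
  · exact mul_mem_weightIdeal hα' hd (by omega)

theorem contactEquiv_of_bijective {f g : MvPowerSeries (Fin n) K}
    {φ : MvPowerSeries (Fin n) K →ₐ[K] MvPowerSeries (Fin n) K} (hφ : Function.Bijective φ)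
    {u : MvPowerSeries (Fin n) K} (hu : IsUnit u) (h : f = u * φ g) : ContactEquiv f g :=
  ⟨AlgEquiv.ofBijective φ hφ, hu.unit, h⟩

/-- Finite determinacy for contact equivalence: `f` is contact `(2 k - o + 2)`-determined, where `o`
is the order of `f`. With `s = k + 1 - o`, the first degree beyond the bound is
`2 k - o + 3 = k + 2 + s`. -/
theorem contactEquiv_of_sub_mem {f g : MvPowerSeries (Fin n) K} {k o s : ℕ}
    (hf : f ∈ weightIdeal K 1 o) (hko : k + 1 = o + s)
    (hk : maxIdeal n K ^ (k + 2) ≤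
      maxIdeal n K * Ideal.span {f} + maxIdeal n K ^ 2 * jac f)
    (hg : g - f ∈ weightIdeal K 1 (k + 2 + s)) : ContactEquiv g f := by
  have hW : ∀ i, 0 < (1 : Fin n → ℕ) i := fun _ => one_pos
  choose Φ hΦ' using exists_algHom_X_add (n := n) (K := K)
  have hΦ : ∀ b : Fin n → MvPowerSeries (Fin n) K, (∀ i, b i ∈ weightIdeal K 1 2) →
      ∀ i, Φ b (X i) = X i + b i := fun b hb =>
    hΦ' b fun i => constantCoeff_eq_zero_of_mem_weightIdeal (hb i) two_pos
  have h0 : Φ 0 f = f := by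
    refine sub_eq_zero.1 (eq_zero_of_forall_mem_weightIdeal (W := 1) fun c => ?_)
    refine weightIdeal_anti 1 (Nat.le_add_left c o)
      (algHom_sub_mem (φ := AlgHom.id K _) hW (X_mem_weightIdeal 1) (e := c) (fun i => ?_) hf)
    simp [hΦ 0 (fun i => by simp) i]
  obtain ⟨u, hu⟩ := exists_seq_of_step
    (α := MvPowerSeries (Fin n) K × (Fin n → MvPowerSeries (Fin n) K))
    (Q := fun j p => p.1 ∈ weightIdeal K 1 1 ∧ (∀ i, p.2 i ∈ weightIdeal K 1 2) ∧
      g - (1 + p.1) * Φ p.2 f ∈ weightIdeal K 1 (k + 2 + s + j))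
    (R := fun j p q => q.1 - p.1 ∈ weightIdeal K 1 (s + 1 + j) ∧
      ∀ i, q.2 i - p.2 i ∈ weightIdeal K 1 (s + 2 + j))
    (x₀ := (0, 0)) (by simpa [h0] using hg)
    (fun j p hp => by
      obtain ⟨a', b', h1, h2⟩ := newton_step hf hko hk Φ hΦ j hp.1 hp.2.1 hp.2.2
      exact ⟨(a', b'), h1, h2⟩)
  obtain ⟨a, ha⟩ := exists_limit (s + 1) (fun j => (u j).1) fun j => (hu j).2.1
  have hblim : ∀ i, ∃ v, ∀ j, v - (u j).2 i ∈ weightIdeal K 1 (s + 2 + j) :=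
    fun i => exists_limit (s + 2) (fun j => (u j).2 i) fun j => (hu j).2.2 i
  choose b hb using hblim
  have ha1 : a ∈ weightIdeal K 1 1 := by
    have := Ideal.add_mem _ (weightIdeal_anti 1 (by omega) (ha 0)) (hu 0).1.1
    rwa [sub_add_cancel] at this
  have hb2 : ∀ i, b i ∈ weightIdeal K 1 2 := fun i => by
    have := Ideal.add_mem _ (weightIdeal_anti 1 (by omega) (hb i 0)) ((hu 0).1.2.1 i)
    rwa [sub_add_cancel] at this
  have hX : ∀ i, Φ b (X i) - X i ∈ weightIdeal K 1 ((1 : Fin n → ℕ) i + 1) := fun i => by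
    rw [hΦ b hb2, add_sub_cancel_left]
    exact hb2 i
  refine contactEquiv_of_bijective (bijective_of_sub_mem hW hX) (isUnit_one_add one_pos ha1)
    (sub_eq_zero.1 (eq_zero_of_forall_mem_weightIdeal (W := 1) fun j => ?_))
  have hXj : ∀ i, Φ (u j).2 (X i) ∈ weightIdeal K 1 ((1 : Fin n → ℕ) i) := fun i => by
    rw [hΦ _ (hu j).1.2.1]
    exact Ideal.add_mem _ (X_mem_weightIdeal 1 i)
      (weightIdeal_anti 1 one_le_two ((hu j).1.2.1 i))
  have hd := algHom_sub_mem hW hXj (φ' := Φ b) (e := j) (fun i => by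
    rw [hΦ b hb2, hΦ _ (hu j).1.2.1, add_sub_add_left_eq_sub]
    exact weightIdeal_anti 1 (by simp) (hb i j)) hf
  have key : g - (1 + a) * Φ b f = (g - (1 + (u j).1) * Φ (u j).2 f) -
      (a - (u j).1) * Φ b f - (1 + (u j).1) * (Φ b f - Φ (u j).2 f) := by ring
  rw [key]
  refine Ideal.sub_mem _ (Ideal.sub_mem _ ?_ ?_) ?_
  · exact weightIdeal_anti 1 (by omega) (hu j).1.2.2
  · exact Ideal.mul_mem_right _ _ (weightIdeal_anti 1 (by omega) (ha j))
  · exact Ideal.mul_mem_left _ _ (weightIdeal_anti 1 (by omega) hd)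

/-! ### Contact equivalence is an equivalence relation -/

theorem ContactEquiv.refl (f : MvPowerSeries (Fin n) K) : ContactEquiv f f :=
  ⟨AlgEquiv.refl, 1, by simp⟩

theorem ContactEquiv.symm {f g : MvPowerSeries (Fin n) K} (h : ContactEquiv f g) :
    ContactEquiv g f := by
  obtain ⟨φ, u, rfl⟩ := h
  refine ⟨φ.symm, (Units.map (φ.symm : MvPowerSeries (Fin n) K →* MvPowerSeries (Fin n) K)) u⁻¹,
    ?_⟩
  rw [map_mul, AlgEquiv.symm_apply_apply, ← mul_assoc]
  have : ((Units.map (φ.symm : MvPowerSeries (Fin n) K →* MvPowerSeries (Fin n) K)) u⁻¹ :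
      MvPowerSeries (Fin n) K) * φ.symm u = 1 := by
    change φ.symm _ * φ.symm u = 1
    rw [← map_mul, Units.inv_mul, map_one]
  rw [this, one_mul]

theorem ContactEquiv.trans {f g h : MvPowerSeries (Fin n) K} (h₁ : ContactEquiv f g)
    (h₂ : ContactEquiv g h) : ContactEquiv f h := by
  obtain ⟨φ, u, rfl⟩ := h₁
  obtain ⟨ψ, v, rfl⟩ := h₂
  refine ⟨ψ.trans φ, u * Units.map (φ : MvPowerSeries (Fin n) K →* MvPowerSeries (Fin n) K) v, ?_⟩
  rw [map_mul, ← mul_assoc]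
  rfl

theorem algEquiv_X_mem_maxIdeal (φ : MvPowerSeries (Fin n) K ≃ₐ[K] MvPowerSeries (Fin n) K)
    (i : Fin n) : φ (X i) ∈ maxIdeal n K := by
  rw [mem_maxIdeal_iff]
  by_contra h0
  have h1 : IsUnit (φ (X i)) := isUnit_iff_constantCoeff.2 (isUnit_iff_ne_zero.2 h0)
  have h2 : IsUnit (X i : MvPowerSeries (Fin n) K) := by
    simpa using h1.map φ.symm
  rw [isUnit_iff_constantCoeff] at h2
  simp at h2

/-! ### The piecewise filtration in terms of integral weights -/

namespace CPolytope

variable (P : CPolytope n)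

theorem N_pos : 0 < P.N := by
  refine Nat.pos_of_ne_zero fun h => ?_
  obtain ⟨w, -, h1⟩ := (Finset.lcm_eq_zero_iff).1 h
  obtain ⟨j, -, h2⟩ := (Finset.lcm_eq_zero_iff).1 h1
  exact (w j).den_ne_zero h2

/-- The natural weight vectors `N_P • w`, where `w` is one of the weights of `P`. -/
def IsIntegralWeight (W : Fin n → ℕ) : Prop :=
  ∃ w ∈ P.weights, ∀ j, (W j : ℝ) = P.N * (w j : ℝ)

theorem exists_integralWeight {w : Fin n → ℚ} (hw : w ∈ P.weights) :
    ∃ W : Fin n → ℕ, ∀ j, (W j : ℝ) = P.N * (w j : ℝ) := by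
  have key : ∀ j, ∃ m : ℕ, (m : ℝ) = (P.N : ℝ) * (w j : ℝ) := by
    intro j
    obtain ⟨c, hc⟩ : (w j).den ∣ P.N :=
      (Finset.dvd_lcm (f := fun j => (w j).den) (Finset.mem_univ j)).trans
        (Finset.dvd_lcm (f := fun w : Fin n → ℚ => Finset.univ.lcm fun j => (w j).den) hw)
    have hnum : ((w j).num.toNat : ℤ) = (w j).num :=
      Int.toNat_of_nonneg (Rat.num_nonneg.2 (P.weights_pos w hw j).le)
    have h3 : ((c * (w j).num.toNat : ℕ) : ℚ) = P.N * w j := by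
      have h2 : ((w j).den : ℚ) * w j = (w j).num := Rat.den_mul_eq_num (w j)
      have h4 : (((w j).num.toNat : ℕ) : ℚ) = (w j).num := by exact_mod_cast hnum
      rw [hc, Nat.cast_mul, Nat.cast_mul, h4, ← h2]
      ring
    exact ⟨c * (w j).num.toNat, by exact_mod_cast h3⟩
  choose W hW using key
  exact ⟨W, hW⟩

variable {P}

theorem IsIntegralWeight.pos {W : Fin n → ℕ} (hW : P.IsIntegralWeight W) (j : Fin n) :
    0 < W j := by
  obtain ⟨w, hw, h⟩ := hW
  have h1 : (0 : ℝ) < w j := by exact_mod_cast P.weights_pos w hw j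
  have h2 : (0 : ℝ) < W j := by
    rw [h]
    exact mul_pos (by exact_mod_cast P.N_pos) h1
  exact_mod_cast h2

variable (P)

theorem exists_isIntegralWeight : ∃ W, P.IsIntegralWeight W := by
  obtain ⟨w, hw⟩ := P.weights_nonempty
  obtain ⟨W, hW⟩ := P.exists_integralWeight hw
  exact ⟨W, w, hw, hW⟩

theorem le_deg_iff {x : ℝ} {a : Fin n → ℤ} :
    x ≤ P.deg a ↔ ∀ W, P.IsIntegralWeight W → x ≤ ∑ j, (W j : ℝ) * (a j : ℝ) := by
  have hN : (0 : ℝ) < P.N := by exact_mod_cast P.N_pos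
  have h1 : x ≤ P.deg a ↔ ∀ w ∈ P.weights, x / P.N ≤ ∑ j, (w j : ℝ) * (a j : ℝ) := by
    rw [deg, ← div_le_iff₀' hN, lam, Finset.le_inf'_iff]
  have h2 : ∀ (W : Fin n → ℕ) (w : Fin n → ℚ), (∀ j, (W j : ℝ) = P.N * (w j : ℝ)) →
      (x / P.N ≤ ∑ j, (w j : ℝ) * (a j : ℝ) ↔ x ≤ ∑ j, (W j : ℝ) * (a j : ℝ)) := by
    intro W w hW
    rw [div_le_iff₀' hN, Finset.mul_sum]
    simp only [hW, mul_assoc]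
  rw [h1]
  constructor
  · rintro H W ⟨w, hw, hW⟩
    exact (h2 W w hW).1 (H w hw)
  · intro H w hw
    obtain ⟨W, hW⟩ := P.exists_integralWeight hw
    exact (h2 W w hW).2 (H W ⟨w, hw, hW⟩)

theorem natCast_weight (W : Fin n → ℕ) (α : Fin n →₀ ℕ) :
    ((Finsupp.weight W α : ℕ) : ℝ) = ∑ j, (W j : ℝ) * (α j : ℝ) := by
  rw [Finsupp.weight_apply, Finsupp.sum_fintype _ _ (by simp)]
  push_cast
  exact Finset.sum_congr rfl fun j _ => by simp [mul_comm]

theorem le_monDeg_iff {d : ℕ} {α : Fin n →₀ ℕ} :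
    d ≤ P.monDeg α ↔ ∀ W, P.IsIntegralWeight W → d ≤ Finsupp.weight W α := by
  rw [← Nat.cast_le (α := ℝ), cast_monDeg, expDeg, le_deg_iff]
  refine forall₂_congr fun W _ => ?_
  rw [← Nat.cast_le (α := ℝ), natCast_weight]
  simp

theorem mem_filt_iff_monDeg {d : ℕ} {h : MvPowerSeries (Fin n) K} :
    h ∈ P.filt K d ↔ ∀ α, coeff α h ≠ 0 → d ≤ P.monDeg α := by
  change ((d : ℝ) : EReal) ≤ P.val h ↔ _
  rw [le_val_iff]
  refine forall₂_congr fun α _ => ?_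
  rw [EReal.coe_le_coe_iff, ← cast_monDeg, Nat.cast_le]

theorem mem_filt_iff {d : ℕ} {h : MvPowerSeries (Fin n) K} :
    h ∈ P.filt K d ↔ ∀ W, P.IsIntegralWeight W → h ∈ weightIdeal K W d := by
  rw [mem_filt_iff_monDeg]
  simp only [le_monDeg_iff, mem_weightIdeal]
  exact ⟨fun H W hW α hα => H α hα W hW, fun H α hα W hW => H W hW α hα⟩

theorem filt_anti {c d : ℕ} (h : c ≤ d) : P.filt K d ≤ P.filt K c := fun _ hf =>
  (P.mem_filt_iff_monDeg).2 fun α hα => h.trans ((P.mem_filt_iff_monDeg).1 hf α hα)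

theorem derivation_X_mem_weightIdeal {e : ℕ}
    {ξ : Derivation K (MvPowerSeries (Fin n) K) (MvPowerSeries (Fin n) K)}
    (hξ : ((e : ℝ) : EReal) ≤ P.derVal ξ) {W : Fin n → ℕ} (hW : P.IsIntegralWeight W)
    (i : Fin n) : ξ (X i) ∈ weightIdeal K W (W i + e) := by
  classical
  intro α hα
  have h1 := EReal.coe_le_coe_iff.1 ((P.le_derVal_iff).1 hξ i α hα)
  have h2 := (P.le_deg_iff).1 h1 W hW
  rw [← Nat.cast_le (α := ℝ), natCast_weight]
  push_cast at h2 ⊢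
  simp only [mul_sub, Finset.sum_sub_distrib] at h2
  have h3 : ∑ j, (W j : ℝ) * (((Pi.single i 1 : Fin n → ℤ) j : ℤ) : ℝ) = W i := by
    rw [Finset.sum_eq_single i]
    · simp
    · intro j _ hj
      simp [Pi.single_eq_of_ne hj]
    · simp
  linarith

/-! ### Initial forms -/

/-- The valuation of a nonzero power series is attained by one of its monomials. -/
theorem exists_val_eq {f : MvPowerSeries (Fin n) K} (hf : f ≠ 0) :
    ∃ α, coeff α f ≠ 0 ∧ P.val f = ((P.monDeg α : ℝ) : EReal) := by
  have hex : ∃ v α, coeff α f ≠ 0 ∧ P.monDeg α = v := by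
    obtain ⟨α, hα⟩ := (ne_zero_iff_exists_coeff_ne_zero f).1 hf
    exact ⟨_, α, hα, rfl⟩
  classical
  obtain ⟨α, hα, hv⟩ := Nat.find_spec hex
  refine ⟨α, hα, le_antisymm ?_ ?_⟩
  · rw [cast_monDeg]
    exact iInf₂_le α hα
  · rw [hv]
    exact (P.mem_filt_iff_monDeg).2 fun β hβ => Nat.find_min' hex ⟨β, hβ, rfl⟩

theorem coeff_initialForm {f : MvPowerSeries (Fin n) K} {v : ℕ}
    (hv : P.val f = ((v : ℝ) : EReal)) (α : Fin n →₀ ℕ) :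
    coeff α (P.initialForm f) = if P.monDeg α = v then coeff α f else 0 := by
  change (if (P.expDeg α : EReal) = P.val f then coeff α f else 0) = _
  simp only [hv, ← cast_monDeg, EReal.coe_eq_coe_iff, Nat.cast_inj]

theorem val_initialForm {f : MvPowerSeries (Fin n) K} (hf : f ≠ 0) :
    P.val (P.initialForm f) = P.val f := by
  obtain ⟨α, hα, hv⟩ := P.exists_val_eq hf
  refine le_antisymm ?_ ?_
  · rw [hv, cast_monDeg]
    exact iInf₂_le α (by rwa [P.coeff_initialForm hv, if_pos rfl])
  · rw [hv]
    refine (P.mem_filt_iff_monDeg).2 fun β hβ => ?_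
    rw [P.coeff_initialForm hv] at hβ
    exact (of_not_not fun h => hβ (if_neg (Ne.symm h))).le

theorem sub_initialForm_mem {f : MvPowerSeries (Fin n) K} {v : ℕ}
    (hv : P.val f = ((v : ℝ) : EReal)) : f - P.initialForm f ∈ P.filt K (v + 1) := by
  refine (P.mem_filt_iff_monDeg).2 fun α hα => ?_
  rw [map_sub, P.coeff_initialForm hv] at hα
  have h1 : P.monDeg α ≠ v := fun h => by simp [h] at hα
  rw [if_neg h1, sub_zero] at hα
  have h2 := (P.mem_filt_iff_monDeg (d := v)).1 hv.ge α hα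
  omega

/-! ### Elimination of terms outside the regular basis -/

theorem le_of_add_le_add_coe {x : EReal} {e v : ℕ}
    (h : (((v + e : ℕ) : ℝ) : EReal) ≤ x + ((v : ℝ) : EReal)) : ((e : ℝ) : EReal) ≤ x := by
  by_contra hlt
  refine absurd h (not_le.2 ?_)
  have := EReal.add_lt_add_right_coe (not_le.1 hlt) (v : ℝ)
  rwa [← EReal.coe_add, ← Nat.cast_add, add_comm e v] at this

/-- A change of coordinates `xᵢ ↦ xᵢ - ξ xᵢ` and multiplication by `1 - g` remove the term
`g h₀ + ξ h₀ ∈ tj` from `f`, up to terms of higher degree. -/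
theorem exists_contactEquiv_sub {f h₀ t : MvPowerSeries (Fin n) K} {v e : ℕ} (he : 0 < e)
    (hv : P.val h₀ = ((v : ℝ) : EReal)) (hf : f - h₀ ∈ P.filt K (v + 1))
    (ht : t ∈ P.tjAC h₀ (v + e)) :
    ∃ f', ContactEquiv f' f ∧ f' - (f - t) ∈ P.filt K (v + e + 1) := by
  obtain ⟨g, ξ, hmin, rfl⟩ := ht
  rw [le_min_iff, hv] at hmin
  have hg : ∀ W, P.IsIntegralWeight W → g ∈ weightIdeal K W e :=
    (P.mem_filt_iff).1 (le_of_add_le_add_coe hmin.1)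
  have hξ := le_of_add_le_add_coe hmin.2
  have hξX : ∀ W, P.IsIntegralWeight W → ∀ i, ξ (X i) ∈ weightIdeal K W (W i + e) :=
    fun W hW i => P.derivation_X_mem_weightIdeal hξ hW i
  obtain ⟨W₀, hW₀⟩ := P.exists_isIntegralWeight
  obtain ⟨φ, hφ⟩ := exists_algHom_X_add fun i => -ξ (X i)
  replace hφ : ∀ i, φ (X i) = X i + -ξ (X i) := hφ fun i => by
    rw [map_neg, constantCoeff_eq_zero_of_mem_weightIdeal (hξX W₀ hW₀ i) (by omega), neg_zero]
  have hφX : ∀ W, P.IsIntegralWeight W → ∀ i, φ (X i) - X i ∈ weightIdeal K W (W i + e) :=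
    fun W hW i => by
      rw [hφ, add_sub_cancel_left]
      exact (Ideal.neg_mem_iff _).2 (hξX W hW i)
  have hbij : Function.Bijective φ := bijective_of_sub_mem hW₀.pos fun i =>
    weightIdeal_anti W₀ (by omega) (hφX W₀ hW₀ i)
  have hunit : IsUnit (1 - g) := by
    rw [sub_eq_add_neg]
    exact isUnit_one_add he ((Ideal.neg_mem_iff _).2 (hg W₀ hW₀))
  refine ⟨(1 - g) * φ f, contactEquiv_of_bijective hbij hunit rfl, ?_⟩
  rw [mem_filt_iff]
  intro W hW
  let D : MvPowerSeries (Fin n) K →ₗ[K] MvPowerSeries (Fin n) K := -ξ.toLinearMap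
  have hDapp : ∀ h, D h = -ξ h := fun _ => rfl
  have hD : IsTwistedDerivation (AlgHom.id K _) (AlgHom.id K _) D := by
    intro a b
    simp only [hDapp, Derivation.leibniz, smul_eq_mul, AlgHom.coe_id, id]
    ring
  have hDX : ∀ i, D (X i) = φ (X i) - AlgHom.id K _ (X i) := fun i => by
    rw [hDapp, hφ, AlgHom.id_apply, add_sub_cancel_left]
  have hDe : ∀ i, D (X i) ∈ weightIdeal K W (W i + e) := fun i => by
    rw [hDX]
    exact hφX W hW i
  have hid : ∀ i, AlgHom.id K (MvPowerSeries (Fin n) K) (X i) ∈ weightIdeal K W (W i) :=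
    X_mem_weightIdeal W
  have hφ1 : ∀ i, φ (X i) ∈ weightIdeal K W (W i) := fun i => by
    have := Ideal.add_mem _ (weightIdeal_anti W (Nat.le_add_right _ _) (hφX W hW i))
      (X_mem_weightIdeal W i)
    rwa [sub_add_cancel] at this
  have hsub := (P.mem_filt_iff).1 hf W hW
  have hh₀ : h₀ ∈ weightIdeal K W v := (P.mem_filt_iff (d := v)).1 hv.ge W hW
  have hfv : f ∈ weightIdeal K W v := by
    have := Ideal.add_mem _ (weightIdeal_anti W (Nat.le_succ _) hsub) hh₀
    rwa [sub_add_cancel] at this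
  have hT := hD.taylor hW.pos hid hφ1 hDe hDX hfv
  have hDf := hD.mem_weightIdeal hW.pos hid hid hDe hfv
  have hDsub := hD.mem_weightIdeal hW.pos hid hid hDe hsub
  have key : (1 - g) * φ f - (f - (g * h₀ + ξ h₀)) =
      (1 - g) * (φ f - AlgHom.id K _ f - D f) - g * (f - h₀) + D (f - h₀) - g * D f := by
    simp only [hDapp, AlgHom.id_apply, map_sub]
    ring
  rw [key]
  refine Ideal.sub_mem _ (Ideal.add_mem _ (Ideal.sub_mem _ ?_ ?_) ?_) ?_
  · exact Ideal.mul_mem_left _ _ (weightIdeal_anti W (by omega) hT)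
  · exact mul_mem_weightIdeal (hg W hW) hsub (by omega)
  · exact weightIdeal_anti W (by omega) hDsub
  · exact mul_mem_weightIdeal (hg W hW) hDf (by omega)

variable (K) in
/-- The `K`-span of the monomials with exponents in `S`. -/
def monomialSpan (S : Set (Fin n →₀ ℕ)) : Submodule K (MvPowerSeries (Fin n) K) :=
  Submodule.span K ((fun α => monomial α (1 : K)) '' S)

theorem monomialSpan_mono {S T : Set (Fin n →₀ ℕ)} (h : S ⊆ T) :
    monomialSpan K S ≤ monomialSpan K T := Submodule.span_mono (Set.image_mono h)

theorem monomialSpan_le {S : Set (Fin n →₀ ℕ)} {I : Ideal (MvPowerSeries (Fin n) K)}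
    (h : ∀ α ∈ S, monomial α (1 : K) ∈ I) : ∀ q ∈ monomialSpan K S, q ∈ I := by
  have : monomialSpan K S ≤ I.restrictScalars K := by
    refine Submodule.span_le.2 ?_
    rintro _ ⟨α, hα, rfl⟩
    exact h α hα
  exact this

theorem monomial_mem_filt_of_le {d : ℕ} {α : Fin n →₀ ℕ} (h : d ≤ P.monDeg α) :
    monomial α (1 : K) ∈ P.filt K d := P.filt_anti h (P.monomial_mem_filt α)

/-- The monomials of degree `d` in a regular basis span `F_d` modulo `tj_d + F_{d+1}`. -/
theorem exists_sub_mem_tjAC_sup {h₀ : MvPowerSeries (Fin n) K} {Λ : Set (Fin n →₀ ℕ)}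
    (hspan : Submodule.span K (P.monClass h₀ '' Λ) = ⊤) {d : ℕ} {h : MvPowerSeries (Fin n) K}
    (hh : h ∈ P.filt K d) :
    ∃ q ∈ monomialSpan K {α | α ∈ Λ ∧ P.monDeg α = d},
      h - q ∈ P.tjAC h₀ d ⊔ P.filt K (d + 1) := by
  have hsub : ∀ q ∈ monomialSpan K {α | α ∈ Λ ∧ P.monDeg α = d}, q ∈ P.filt K d :=
    monomialSpan_le fun α hα => P.monomial_mem_filt_of_le hα.2.ge
  have key : ∀ z : P.Gr h₀, z ∈ Submodule.span K (P.monClass h₀ '' Λ) →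
      ∃ q : P.filt K d, (q : MvPowerSeries (Fin n) K) ∈
        monomialSpan K {α | α ∈ Λ ∧ P.monDeg α = d} ∧
        (Submodule.Quotient.mk q : P.GrPiece h₀ d) = z d := by
    intro z hz
    induction hz using Submodule.span_induction with
    | mem z hz =>
      obtain ⟨α, hα, rfl⟩ := hz
      by_cases hd : P.monDeg α = d
      · subst hd
        exact ⟨⟨monomial α 1, P.monomial_mem_filt α⟩,
          Submodule.subset_span ⟨α, ⟨hα, rfl⟩, rfl⟩, by
            rw [monClass, DirectSum.of_eq_same]⟩
      · exact ⟨0, Submodule.zero_mem _, by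
          rw [monClass, DirectSum.of_eq_of_ne _ _ _ (Ne.symm hd), Submodule.Quotient.mk_zero]⟩
    | zero => exact ⟨0, Submodule.zero_mem _, rfl⟩
    | add x y _ _ hx hy =>
      obtain ⟨q, hq, hqx⟩ := hx
      obtain ⟨r, hr, hry⟩ := hy
      refine ⟨q + r, Submodule.add_mem _ hq hr, ?_⟩
      rw [Submodule.Quotient.mk_add, hqx, hry]
      rfl
    | smul c x _ hx =>
      obtain ⟨q, hq, hqx⟩ := hx
      refine ⟨c • q, Submodule.smul_mem _ c hq, ?_⟩
      rw [Submodule.Quotient.mk_smul, hqx]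
      rfl
  obtain ⟨q, hq, hqz⟩ := key (DirectSum.of (P.GrPiece h₀) d (Submodule.Quotient.mk ⟨h, hh⟩))
    (by rw [hspan]; trivial)
  rw [DirectSum.of_eq_same] at hqz
  refine ⟨q, hq, ?_⟩
  exact (Submodule.Quotient.eq (Submodule.comap (P.filt K d).subtype
    (P.tjAC h₀ d ⊔ P.filt K (d + 1)))).1 hqz.symm

/-- Elimination of all terms of degree below `d₀ + m` that are not in the regular basis. -/
theorem exists_contactEquiv_mem_filt {f h₀ : MvPowerSeries (Fin n) K} {Λ : Set (Fin n →₀ ℕ)}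
    (hspan : Submodule.span K (P.monClass h₀ '' Λ) = ⊤) {v d₀ : ℕ}
    (hv : P.val h₀ = ((v : ℝ) : EReal)) (hvd : v < d₀) (hf : f - h₀ ∈ P.filt K d₀) (m : ℕ) :
    ∃ q ∈ monomialSpan K {α | α ∈ Λ ∧ d₀ ≤ P.monDeg α}, ∃ f', ContactEquiv f f' ∧
      f' - (h₀ + q) ∈ P.filt K (d₀ + m) := by
  induction m with
  | zero => exact ⟨0, Submodule.zero_mem _, f, ContactEquiv.refl f, by simpa using hf⟩
  | succ m ih =>
    obtain ⟨q, hq, f', hff', hf'⟩ := ih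
    obtain ⟨q', hq', hmem⟩ := P.exists_sub_mem_tjAC_sup hspan hf'
    obtain ⟨t, ht, r, hr, htr⟩ := Submodule.mem_sup.1 hmem
    obtain ⟨e, he⟩ : ∃ e, d₀ + m = v + e := ⟨d₀ + m - v, by omega⟩
    have hqF : q ∈ P.filt K (v + 1) :=
      monomialSpan_le (fun α hα => P.monomial_mem_filt_of_le (hvd.trans_le hα.2)) q hq
    have hsub : f' - h₀ ∈ P.filt K (v + 1) := by
      have := Ideal.add_mem _ (P.filt_anti (by omega) hf') hqF
      convert this using 1
      ring
    rw [he] at ht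
    obtain ⟨f'', hf'', hmem''⟩ := P.exists_contactEquiv_sub (by omega) hv hsub ht
    have hS : {α | α ∈ Λ ∧ P.monDeg α = d₀ + m} ⊆ {α | α ∈ Λ ∧ d₀ ≤ P.monDeg α} := by
      rintro α ⟨hα, hd⟩
      exact ⟨hα, by omega⟩
    refine ⟨q + q', Submodule.add_mem _ hq (monomialSpan_mono hS hq'), f'',
      hff'.trans hf''.symm, ?_⟩
    · rw [← he] at hmem''
      have heq : f'' - (h₀ + (q + q')) = f'' - (f' - t) + r := by linear_combination -htr
      rw [heq]
      exact Ideal.add_mem _ hmem'' hr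

/-- High piecewise degree forces high order. -/
theorem exists_filt_le_weightIdeal_one (L : ℕ) : ∃ D, P.filt K D ≤ weightIdeal K 1 L := by
  obtain ⟨W, hW⟩ := P.exists_isIntegralWeight
  refine ⟨(∑ i, W i + 1) * L, fun h hh α hα => ?_⟩
  have h1 := (P.mem_filt_iff).1 hh W hW α hα
  by_contra hlt
  have h2 : Finsupp.weight W α ≤ (∑ i, W i) * Finsupp.weight (1 : Fin n → ℕ) α := by
    simp only [Finsupp.weight_apply, Finsupp.sum, smul_eq_mul, Finset.mul_sum, Pi.one_apply,
      mul_one]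
    exact Finset.sum_le_sum fun i _ => by
      rw [mul_comm]
      exact Nat.mul_le_mul_right _ (Finset.single_le_sum (fun _ _ => Nat.zero_le _)
        (Finset.mem_univ i))
  have h3 := Nat.mul_le_mul_left (∑ i, W i) (not_le.1 hlt).le
  rw [add_mul, one_mul] at h1
  have := not_le.1 hlt
  linarith

end CPolytope

end SingNF

end

/-! ### The normal form -/

open SingNF MvPowerSeries in
theorem theorem4p4 {K : Type*} [Field K] [IsAlgClosed K] {n : ℕ} (hn : 1 ≤ n)
    (f : MvPowerSeries (Fin n) K) (hf : f ∈ SingNF.maxIdeal n K)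
    (P : SingNF.CPolytope n) (Λ : Set (Fin n →₀ ℕ))
    (hΛ : P.IsRegularBasis (P.initialForm f) Λ) (k : ℕ)
    (hk : SingNF.maxIdeal n K ^ (k + 2) ≤
      SingNF.maxIdeal n K * Ideal.span {f} + SingNF.maxIdeal n K ^ 2 * SingNF.jac f) :
    ∃ (hfin : (P.normalFormExponents f Λ k).Finite) (c : (Fin n →₀ ℕ) → K),
      SingNF.ContactEquiv f
        (P.initialForm f + ∑ α ∈ hfin.toFinset, MvPowerSeries.monomial α (c α)) := by
  have hfin : (P.normalFormExponents f Λ k).Finite := by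
    refine (Finsupp.finite_of_degree_le (σ := Fin n) (2 * k + 2)).subset fun α hα => ?_
    have h1 : (α.degree : ℕ∞) ≤ ((2 * k + 2 : ℕ) : ℕ∞) :=
      le_self_add.trans (hα.2.1.trans (by push_cast; rfl))
    exact Nat.cast_le.1 h1
  refine ⟨hfin, ?_⟩
  by_cases hne : f - P.initialForm f = 0
  · refine ⟨0, ?_⟩
    rw [← sub_eq_zero.1 hne]
    simpa using ContactEquiv.refl f
  have hf0 : f ≠ 0 := by
    rintro rfl
    have := le_of_mem_weightIdeal_one hn (c := k + 2) (by omega) hk (Ideal.zero_mem _)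
    omega
  -- The order `o` of `f` satisfies `1 ≤ o ≤ k + 1`; the slack `s` makes `k + 2 + s` the first
  -- degree above the determinacy bound `2 k - o + 2`.
  obtain ⟨o, ho⟩ : ∃ o : ℕ, f.order = o := ⟨_, (ne_zero_iff_order_finite.1 hf0).symm⟩
  have hfo : f ∈ weightIdeal K 1 o := by
    intro α hα
    have h1 := order_le hα
    rw [ho, Nat.cast_le, Finsupp.degree_eq_weight_one] at h1
    exact h1
  have ho1 : 1 ≤ o := by
    have h1 : f.order ≠ 0 := order_ne_zero_iff_constCoeff_eq_zero.2 (mem_maxIdeal_iff.1 hf)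
    rw [ho] at h1
    exact Nat.one_le_iff_ne_zero.2 (by exact_mod_cast h1)
  obtain ⟨s, hs⟩ := Nat.exists_eq_add_of_le (le_of_mem_weightIdeal_one hn ho1 hk hfo)
  obtain ⟨α₀, -, hv⟩ := P.exists_val_eq hf0
  obtain ⟨β₀, hβ₀, hd₀⟩ := P.exists_val_eq hne
  have hvd : P.monDeg α₀ < P.monDeg β₀ :=
    (P.mem_filt_iff_monDeg).1 (P.sub_initialForm_mem hv) β₀ hβ₀
  obtain ⟨D, hD⟩ := P.exists_filt_le_weightIdeal_one (K := K) (k + 2 + s)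
  obtain ⟨q, hq, f', hff', hf'⟩ := P.exists_contactEquiv_mem_filt hΛ.2
    ((P.val_initialForm hf0).trans hv) hvd hd₀.ge D
  -- Split off the monomials of high order.
  have hsplit : {α | α ∈ Λ ∧ P.monDeg β₀ ≤ P.monDeg α} ⊆
      P.normalFormExponents f Λ k ∪ {α | k + 2 + s ≤ Finsupp.weight (1 : Fin n → ℕ) α} := by
    rintro α ⟨hα, hd⟩
    by_cases h : k + 2 + s ≤ Finsupp.weight (1 : Fin n → ℕ) α
    · exact Or.inr h
    · refine Or.inl ⟨hα, ?_, ?_⟩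
      · have h1 : α.degree = Finsupp.weight (1 : Fin n → ℕ) α := by
          rw [Finsupp.degree_eq_weight_one]
          rfl
        rw [ho]
        have h2 : α.degree + o ≤ 2 * k + 2 := by omega
        exact_mod_cast h2
      · rw [hd₀]
        exact P.monomial_mem_filt_of_le hd
  have hq' := CPolytope.monomialSpan_mono (K := K) hsplit hq
  rw [CPolytope.monomialSpan, Set.image_union, Submodule.span_union] at hq'
  obtain ⟨q₁, hq₁, q₂, hq₂, rfl⟩ := Submodule.mem_sup.1 hq'
  have hq₂' : q₂ ∈ weightIdeal K 1 (k + 2 + s) :=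
    CPolytope.monomialSpan_le (fun α hα => monomial_mem_weightIdeal hα 1) q₂ hq₂
  rw [← hfin.coe_toFinset, Submodule.mem_span_image_finset_iff_exists_fun'] at hq₁
  obtain ⟨c, hc⟩ := hq₁
  refine ⟨c, ?_⟩
  have hsum : ∑ α ∈ hfin.toFinset, monomial α (c α) = q₁ := by
    rw [← hc]
    exact Finset.sum_congr rfl fun α _ => by rw [← map_smul, smul_eq_mul, mul_one]
  rw [hsum]
  -- Transport the high-order error to `f`, which is finitely determined.
  have herr : (P.initialForm f + q₁) - f' ∈ weightIdeal K 1 (k + 2 + s) := by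
    have h1 := Ideal.add_mem _ (hD (P.filt_anti (Nat.le_add_left _ _) hf')) hq₂'
    have h2 := (Ideal.neg_mem_iff _).2 h1
    convert h2 using 1
    ring
  obtain ⟨φ, u, hu⟩ := hff'
  have hg : u * φ (P.initialForm f + q₁) - f ∈ weightIdeal K 1 (k + 2 + s) := by
    rw [← maxIdeal_pow] at herr ⊢
    have h1 := algHom_maxIdeal_pow (φ := (φ : _ →ₐ[K] _)) (algEquiv_X_mem_maxIdeal φ) herr
    rw [AlgEquiv.coe_toAlgHom, map_sub] at h1
    have heq : u * φ (P.initialForm f + q₁) - f = u * (φ (P.initialForm f + q₁) - φ f') := by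
      rw [mul_sub, ← hu]
    rw [heq]
    exact Ideal.mul_mem_left _ _ h1
  exact (contactEquiv_of_sub_mem hfo hs hk hg).symm.trans ⟨φ, u, rfl⟩
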